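/- Let $k$ be a finite field and let $\mathcal{A}$ be a finitary hereditary $k$-linear abelian category, that is, a small $k$-linear abelian category such that $\operatorname{Hom}_{\mathcal{A}}(X,Y)$ and $\operatorname{Ext}^1_{\mathcal{A}}(X,Y)$ are finite and $\operatorname{Ext}^n_{\mathcal{A}}(X,Y)=0$ for $n\geq 2$, for all objects $X,Y$ of $\mathcal{A}$. Put $\langle X,Y\rangle=|\operatorname{Hom}_{\mathcal{A}}(X,Y)|/|\operatorname{Ext}^1_{\mathcal{A}}(X,Y)|$. Let $t$ be an odd positive integer and $\mathbb{Z}_t=\mathbb{Z}/t\mathbb{Z}$. A $t$-periodic complex over $\mathcal{A}$ is a family $M^\bullet=(M^i,d^i)_{i\in\mathbb{Z}_t}$ of objects $M^i$ and morphisms $d^i:M^i\to M^{i+1}$ with $d^{i+1}d^i=0$; its shift $M^\bullet[n]$ has components $M^\bullet[n]^i=M^{i+n}$ and differential $(-1)^n d$. Let $\mathcal{D}_t(\mathcal{A})$ be the relative derived category of $t$-periodic complexes, i.e. the localization at the quasi-isomorphisms of the category of $t$-periodic complexes and morphisms modulo homotopies $(s^i:L^i\to M^{i-1})_{i\in\mathbb{Z}_t}$.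 Let $A_1^\bullet=(A_1^i,0)_{i\in\mathbb{Z}_t}$ and $A_2^\bullet=(A_2^i,0)_{i\in\mathbb{Z}_t}$ be $t$-periodic complexes over $\mathcal{A}$ with zero differentials. Then the sets $\operatorname{Hom}_{\mathcal{D}_t(\mathcal{A})}(A_1^\bullet[i],A_2^\bullet)$, $0\le i\le t-1$, are finite and $$\prod_{i=0}^{t-1}|\operatorname{Hom}_{\mathcal{D}_t(\mathcal{A})}(A_1^\bullet[i],A_2^\bullet)|^{(-1)^i}=\prod_{i=0}^{t-1}\left(|\operatorname{Hom}_{\mathcal{A}}(A_1^i,A_2^i)|\,|\operatorname{Ext}^1_{\mathcal{A}}(A_1^i,A_2^i)|\prod_{k=1}^{t-1}\langle A_1^{i+k},A_2^i\rangle^{(-1)^k}\right),$$ where upper indices of $A_1$ and $A_2$ are read modulo $t$. -/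

import Mathlib

open CategoryTheory CategoryTheory.Abelian

universe w v u

/-- An abelian category is hereditary if `Extⁿ(X, Y) = 0` for all objects `X`, `Y` and all
`n ≥ 2`, i.e. if every object has projective dimension at most `1` (this is Mathlib's notion, in
terms of the vanishing of Ext groups; no projective objects need exist). -/
def IsHereditary (A : Type u) [Category.{v} A] [Abelian A] : Prop :=
  ∀ X : A, HasProjectiveDimensionLE X 1

/-- Finiteness of all Hom sets and all `Ext¹` groups. -/
structure IsFinitary (A : Type u) [Category.{v} A] [Abelian A] [HasExt.{w} A] : Prop where
  finite_hom : ∀ X Y : A, Finite (X ⟶ Y)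
  finite_ext : ∀ X Y : A, Finite (Ext X Y 1)

/-- The multiplicative Euler form `⟨X, Y⟩ = |Hom(X, Y)| / |Ext¹(X, Y)|`. -/
noncomputable def eulerForm {A : Type u} [Category.{v} A] [Abelian A] [HasExt.{w} A]
    (X Y : A) : ℚ :=
  (Nat.card (X ⟶ Y) : ℚ) / (Nat.card (Ext X Y 1) : ℚ)

/-- The category `C_t(A)` of `t`-periodic complexes: objects `Mⁱ` for `i ∈ ℤ/t`, with
differentials `Mⁱ ⟶ Mⁱ⁺¹` of square zero (for `t = 1`, an object with a square zero
endomorphism). -/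
abbrev PeriodicComplex (A : Type u) [Category.{v} A] [Abelian A] (t : ℕ) :=
  HomologicalComplex A (ComplexShape.up (ZMod t))

/-- The homotopy category `K_t(A)`: the quotient of `C_t(A)` by relative homotopy, the homotopies
being families `sⁱ : Lⁱ ⟶ Mⁱ⁻¹` indexed by `i ∈ ℤ/t`. -/
abbrev PeriodicHomotopyCategory (A : Type u) [Category.{v} A] [Abelian A] (t : ℕ) :=
  HomotopyCategory A (ComplexShape.up (ZMod t))

/-- The relative derived category `D_t(A)`: the localization of `K_t(A)` with respect to the
class of all quasi-isomorphisms. -/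
abbrev RelativeDerivedCategory (A : Type u) [Category.{v} A] [Abelian A] (t : ℕ) :=
  (HomotopyCategory.quasiIso A (ComplexShape.up (ZMod t))).Localization

namespace PeriodicComplex

variable {A : Type u} [Category.{v} A] [Abelian A] {t : ℕ}

/-- The shift functor `[n]` on `t`-periodic complexes: `(M[n])ⁱ = Mⁱ⁺ⁿ`, with differential
`(-1)ⁿ d`. -/
@[simps]
def shift (n : ℤ) : PeriodicComplex A t ⥤ PeriodicComplex A t where
  obj M :=
    { X := fun i => M.X (i + (n : ZMod t))
      d := fun i j => n.negOnePow • M.d (i + (n : ZMod t)) (j + (n : ZMod t))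
      shape := fun i j hij => by
        have h : ¬ (ComplexShape.up (ZMod t)).Rel (i + (n : ZMod t)) (j + (n : ZMod t)) := by
          intro h
          apply hij
          simp only [ComplexShape.up_Rel] at h ⊢
          exact add_right_cancel ((add_right_comm i 1 (n : ZMod t)).trans h)
        rw [M.shape _ _ h, smul_zero]
      d_comp_d' := fun i j k _ _ => by
        simp only [Linear.comp_units_smul, Linear.units_smul_comp, M.d_comp_d, smul_zero] }
  map f :=
    { f := fun i => f.f (i + (n : ZMod t))
      comm' := fun i j _ => by
        simp only [Linear.comp_units_smul, Linear.units_smul_comp, f.comm] }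
  map_id _ := rfl
  map_comp _ _ := rfl

/-- The canonical functor `C_t(A) ⥤ K_t(A) ⥤ D_t(A)`. -/
noncomputable def toDerived : PeriodicComplex A t ⥤ RelativeDerivedCategory A t :=
  HomotopyCategory.quotient A (ComplexShape.up (ZMod t)) ⋙
    (HomotopyCategory.quasiIso A (ComplexShape.up (ZMod t))).Q

end PeriodicComplex

-- For complexes `M`, `N` with zero differential over a hereditary category, a morphism `M ⟶ N` in
-- the localization amounts to a family of maps `ψ j : M j ⟶ N j` and classes `e j` in `Ext¹(M j, N
-- (j - 1))`; this is `homEquiv`. Such data give a roof: take extensions `0 ⟶ N (j - 1) ⟶ E j ⟶ M j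
-- ⟶ 0` of class `e j`. The complex with terms `N j ⊞ E j` and differential induced by `N (j - 1) ⟶
-- E j` is quasi-isomorphic to `M`, and it maps to `N` by the identity on `N j` and by `E j ⟶ M j ⟶
-- N j`.
--
-- Every morphism arises in this way (`homMk_surjective`). It is a roof `M ⟵ R ⟶ N`, and the
-- vanishing of `Ext²` allows the cycles of `R`, an extension of `M`, to be resolved by extensions
-- as above. The data are unique (`homMk_injective`): reading a complex along a path `ℤ → ι` gives a
-- functor to the ordinary derived category, where `ψ j` and the connecting morphism of `e j` are
-- recovered.
--
-- Counting gives `|Hom(M, N)| = ∏ |Hom(M j, N j)| |Ext¹(M j, N (j - 1))|`. In the alternating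
-- product over the shifts, re-indexing moves each `Ext¹` factor to the next shift with the opposite
-- sign; since `t` is odd, the last one wraps around to the unshifted term with sign `+`
-- (`prod_range_zpow_eq`).

universe w'

/-! ### Classes in `Ext¹` as short exact sequences. -/

section

open Limits

namespace HomologicalComplex

variable {A : Type u} [Category.{v} A] [Abelian A] {ι : Type*} {c : ComplexShape ι}

/-- If `f` is a quasi-isomorphism at `i` and the differentials of the target vanish, then already
the cycles of the source map onto the target. -/
lemma epi_iCycles_comp_of_quasiIsoAt {K L : HomologicalComplex A c} (f : K ⟶ L) (i : ι)
    [QuasiIsoAt f i] (h₁ : L.d (c.prev i) i = 0) (h₂ : L.d i (c.next i) = 0) :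
    Epi (K.iCycles i ≫ f.f i) := by
  have : IsIso (L.homologyπ i) := L.isIso_homologyπ _ i rfl h₁
  have : IsIso (L.iCycles i) := L.isIso_iCycles i _ rfl h₂
  have : Epi (cyclesMap f i) := by
    have : cyclesMap f i = K.homologyπ i ≫ homologyMap f i ≫ inv (L.homologyπ i) := by simp
    rw [this]
    infer_instance
  rw [← cyclesMap_i]
  infer_instance

lemma epi_f_of_quasiIsoAt {K L : HomologicalComplex A c} (f : K ⟶ L) (i : ι)
    [QuasiIsoAt f i] (h₁ : L.d (c.prev i) i = 0) (h₂ : L.d i (c.next i) = 0) :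
    Epi (f.f i) :=
  have := epi_iCycles_comp_of_quasiIsoAt f i h₁ h₂
  epi_of_epi (K.iCycles i) _

end HomologicalComplex

namespace DerivedCategory

/-- Every class in `Ext¹`, as a morphism in the derived category, is annihilated by an
epimorphism. -/
lemma exists_epi_single_map_comp_eq_zero {A : Type u} [Category.{v} A] [Abelian A]
    [HasDerivedCategory.{w} A] {X Y : A}
    (x : Q.obj ((HomologicalComplex.single A (ComplexShape.up ℤ) 0).obj X) ⟶
      (Q.obj
        ((HomologicalComplex.single A (ComplexShape.up ℤ) 0).obj Y))⟦(1 : ℤ)⟧) :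
    ∃ (E : A) (p : E ⟶ X) (_ : Epi p),
      Q.map ((HomologicalComplex.single A (ComplexShape.up ℤ) 0).map p) ≫ x =
        0 := by
  -- The class is a roof through a complex `X'` vanishing in positive degrees. The required
  -- epimorphism is then `X'⁰ ⟶ X`.
  obtain ⟨X', _, s, hs, g, hg⟩ := right_fac_of_isStrictlyLE
    (x ≫ (Q.commShiftIso (1 : ℤ)).inv.app _) 0
  rw [isIso_Q_map_iff_quasiIso] at hs
  let e := HomologicalComplex.singleObjXSelf (ComplexShape.up ℤ) 0 X
  have hepi : Epi (s.f 0) := HomologicalComplex.epi_f_of_quasiIsoAt s 0 (by simp) (by simp)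
  let ι : (HomologicalComplex.single A (ComplexShape.up ℤ) 0).obj (X'.X 0) ⟶ X' :=
    HomologicalComplex.mkHomFromSingle (𝟙 _) fun k hk =>
      (X'.isZero_of_isStrictlyLE 0 k (by simp at hk; omega)).eq_of_tgt _ _
  have h1 : ι ≫ s = (HomologicalComplex.single A _ 0).map (s.f 0 ≫ e.hom) := by
    apply HomologicalComplex.from_single_hom_ext
    rw [HomologicalComplex.single_map_f_self]
    simp [ι, e]
  -- The inclusion of `X'⁰` lives in degree `0`, whereas `Y[1]` lives in degree `-1`.
  have h2 : ι ≫ g = 0 := by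
    apply HomologicalComplex.from_single_hom_ext
    exact (HomologicalComplex.isZero_single_obj_X (ComplexShape.up ℤ) 0 Y (0 + 1)
      (by simp)).eq_of_tgt _ _
  refine ⟨_, s.f 0 ≫ e.hom, inferInstance, ?_⟩
  rw [← h1, Functor.map_comp, Category.assoc,
    ← cancel_mono ((Q.commShiftIso (1 : ℤ)).inv.app _), Category.assoc,
    Category.assoc, hg, IsIso.hom_inv_id_assoc, ← Functor.map_comp, h2, Functor.map_zero,
    Limits.zero_comp]

end DerivedCategory

namespace CategoryTheory.Abelian.Ext

variable {A : Type u} [Category.{v} A] [Abelian A] [HasExt.{w} A]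

/-- A compatible pair of morphisms on the outer terms extends to a morphism of short exact
sequences. -/
lemma exists_shortComplex_hom {S₁ S₂ : ShortComplex A} (h₁ : S₁.ShortExact)
    (h₂ : S₂.ShortExact) (a : S₁.X₁ ⟶ S₂.X₁) (b : S₁.X₃ ⟶ S₂.X₃)
    (hab : h₁.extClass.comp (mk₀ a) (add_zero 1) = (mk₀ b).comp h₂.extClass (zero_add 1)) :
    ∃ φ : S₁ ⟶ S₂, φ.τ₁ = a ∧ φ.τ₃ = b := by
  have := h₂.mono_f
  have := h₁.epi_g
  -- The obstruction to lifting `S₁.g ≫ b` through `S₂.g` is, by `hab`, a multiple of `S₁.g`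
  -- composed with the class of `S₁`, hence zero.
  obtain ⟨x, hx⟩ := covariant_sequence_exact₃ S₁.X₂ h₂ (mk₀ (S₁.g ≫ b)) (zero_add 1) (by
    rw [← mk₀_comp_mk₀, comp_assoc _ _ _ (zero_add 0) (zero_add 1) (by omega), ← hab,
      ShortComplex.ShortExact.comp_extClass_assoc])
  obtain ⟨h, rfl⟩ := addEquiv₀.symm.surjective x
  have hh : h ≫ S₂.g = S₁.g ≫ b := by
    apply addEquiv₀.symm.injective
    simpa using hx
  obtain ⟨a', ha'⟩ : ∃ a', a' ≫ S₂.f = S₁.f ≫ h :=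
    ⟨h₂.exact.lift (S₁.f ≫ h) (by rw [Category.assoc, hh, S₁.zero_assoc, Limits.zero_comp]),
      h₂.exact.lift_f _ _⟩
  let φ : S₁ ⟶ S₂ := ⟨a', h, b, ha', hh⟩
  -- The lift `h` induces some `a'` instead of `a`, but both push the class of `S₁` to the same
  -- class. So `a - a'` extends along `S₁.f` to a map `k`, which corrects `h`.
  have hφ := ShortComplex.ShortExact.extClass_naturality h₁ h₂ φ
  obtain ⟨y, hy⟩ := contravariant_sequence_exact₁ h₁ S₂.X₁ (mk₀ (a - a')) (add_zero 1) (by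
    have : mk₀ (a - a') = mk₀ a - mk₀ a' := by
      simpa using addEquiv₀.symm.map_sub a a'
    rw [this, sub_eq_add_neg, comp_add, comp_neg, hab, ← sub_eq_add_neg, sub_eq_zero]
    exact hφ.symm)
  obtain ⟨k, rfl⟩ := addEquiv₀.symm.surjective y
  have hk : S₁.f ≫ k = a - a' := by
    apply addEquiv₀.symm.injective
    simpa using hy
  exact ⟨⟨a, h + k ≫ S₂.f, b, by
    rw [Preadditive.comp_add, ← ha', reassoc_of% hk, Preadditive.sub_comp]; abel, by
    simp [hh]⟩, rfl, rfl⟩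

/-- Postcomposition with an epimorphism is surjective on `Ext¹` if the source has projective
dimension at most `1`. -/
lemma postcomp_surjective_of_epi (X : A) [HasProjectiveDimensionLE X 1] {Y Z : A} (p : Y ⟶ Z)
    [Epi p] (x : Ext X Z 1) : ∃ y : Ext X Y 1, y.comp (mk₀ p) (add_zero 1) = x := by
  let S := ShortComplex.mk (kernel.ι p) p (kernel.condition p)
  have hS : S.ShortExact := { exact := ShortComplex.exact_kernel p }
  -- The obstruction lies in `Ext²(X, ker p)`.
  exact covariant_sequence_exact₃ X hS x rfl
    (eq_zero_of_hasProjectiveDimensionLT _ 2 le_rfl)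

/-- Every class in `Ext¹` is annihilated by an epimorphism. -/
lemma exists_epi_comp_eq_zero {X Y : A} (x : Ext X Y 1) :
    ∃ (E : A) (p : E ⟶ X) (_ : Epi p), (mk₀ p).comp x (zero_add 1) = 0 := by
  let := HasDerivedCategory.standard A
  obtain ⟨E, p, hp, h⟩ := DerivedCategory.exists_epi_single_map_comp_eq_zero (X := X) (Y := Y) x.hom
  refine ⟨E, p, hp, ?_⟩
  ext
  rw [← singleFunctor_map_comp_hom, zero_hom]
  exact h

/-- Every class in `Ext¹` is the class of a short exact sequence. -/
lemma exists_shortExact {X Y : A} (x : Ext X Y 1) :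
    ∃ (E : A) (i : Y ⟶ E) (p : E ⟶ X) (h : i ≫ p = 0)
      (hS : (ShortComplex.mk i p h).ShortExact), hS.extClass = x := by
  obtain ⟨E, p, _, hp⟩ := exists_epi_comp_eq_zero x
  let S := ShortComplex.mk (kernel.ι p) p (kernel.condition p)
  have hS : S.ShortExact := { exact := ShortComplex.exact_kernel p }
  -- Since `p` kills `x`, the class `x` is the pushforward of the class of `ker p ⟶ E ⟶ X` along
  -- some `k : ker p ⟶ Y`. The pushout along `k` is the extension sought.
  obtain ⟨y, hy⟩ := contravariant_sequence_exact₃ hS Y x hp (add_zero 1)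
  obtain ⟨k, rfl⟩ := addEquiv₀.symm.surjective y
  let p' : pushout S.f k ⟶ X := pushout.desc S.g 0 (by rw [S.zero, Limits.comp_zero])
  have hl : pushout.inl S.f k ≫ p' = S.g := pushout.inl_desc _ _ _
  have hr : pushout.inr S.f k ≫ p' = 0 := pushout.inr_desc _ _ _
  have : Epi S.g := hS.epi_g
  have : Mono S.f := hS.mono_f
  have : Epi p' := epi_of_epi_fac hl
  have hS' : (ShortComplex.mk _ _ hr).ShortExact :=
    { exact := by
        apply ShortComplex.exact_of_g_is_cokernel
        refine CokernelCofork.IsColimit.ofπ' _ _ fun {T} t ht => ?_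
        have h1 : S.f ≫ pushout.inl S.f k ≫ t = 0 := by
          rw [pushout.condition_assoc]
          exact (congrArg (k ≫ ·) ht).trans Limits.comp_zero
        refine ⟨hS.exact.desc _ h1, ?_⟩
        apply pushout.hom_ext
        · rw [reassoc_of% hl, hS.exact.g_desc]
        · rw [reassoc_of% hr, Limits.zero_comp]; exact ht.symm }
  refine ⟨_, _, _, hr, hS', ?_⟩
  let φ : S ⟶ ShortComplex.mk _ _ hr :=
    ⟨k, pushout.inl _ _, 𝟙 _, pushout.condition.symm, hl.trans (Category.comp_id _).symm⟩
  have := ShortComplex.ShortExact.extClass_naturality hS hS' φ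
  rw [← hy]
  simpa [φ] using this.symm

end CategoryTheory.Abelian.Ext

end

/-! ### Acyclic kernels, base change, and sums of two-term complexes. -/

section

open Limits

namespace HomologicalComplex

variable {A : Type u} [Category.{v} A] [Abelian A] {ι : Type*} {c : ComplexShape ι}

/-- In a short exact sequence of complexes with acyclic kernel, the epimorphism is a
quasi-isomorphism. -/
lemma quasiIso_of_shortExact_of_acyclic {S : ShortComplex (HomologicalComplex A c)}
    (hS : S.ShortExact) (h : S.X₁.Acyclic) : QuasiIso S.g := by
  have := hS.epi_g
  refine ⟨fun i => ?_⟩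
  rw [quasiIsoAt_iff_isIso_homologyMap]
  have hm : Mono (homologyMap S.g i) :=
    (hS.homology_exact₂ i).mono_g (((h i).isZero_homology).eq_of_src _ _)
  have he : Epi (homologyMap S.g i) := by
    by_cases! hi : ∃ j, c.Rel i j
    · obtain ⟨j, hij⟩ := hi
      exact (hS.homology_exact₃ i j hij).epi_f (((h j).isZero_homology).eq_of_tgt _ _)
    · exact epi_homologyMap_of_epi_of_not_rel S.g i hi
  exact isIso_of_mono_of_epi _

/-- Quasi-isomorphisms which are epimorphisms are stable under base change. -/
lemma quasiIso_pullback_fst {K L M : HomologicalComplex A c} (f : K ⟶ M) (g : L ⟶ M) [Epi g]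
    [QuasiIso g] : QuasiIso (pullback.fst f g) := by
  let S := ShortComplex.mk (kernel.ι g) g (kernel.condition g)
  have hS : S.ShortExact := { exact := ShortComplex.exact_kernel g }
  have hK : S.X₁.Acyclic := hS.acyclic_X₁ ‹_›
  let k : kernel g ⟶ pullback f g := pullback.lift 0 (kernel.ι g) (by simp)
  have hk : k ≫ pullback.snd f g = kernel.ι g := pullback.lift_snd _ _ _
  have hk' : k ≫ pullback.fst f g = 0 := pullback.lift_fst _ _ _
  have : Mono k := mono_of_mono_fac hk
  let T := ShortComplex.mk k (pullback.fst f g) hk'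
  have hT : T.ShortExact :=
    { mono_f := ‹Mono k›
      exact := by
        apply ShortComplex.exact_of_f_is_kernel
        refine KernelFork.IsLimit.ofι' _ _ fun {Z} t ht => ?_
        have ht' : t ≫ pullback.fst f g = 0 := ht
        refine ⟨kernel.lift g (t ≫ pullback.snd f g) (by
          rw [Category.assoc, ← pullback.condition, reassoc_of% ht', zero_comp]), ?_⟩
        apply pullback.hom_ext
        · exact ((Category.assoc _ _ _).trans (by rw [hk', comp_zero])).trans ht'.symm
        · exact (Category.assoc _ _ _).trans (by rw [hk, kernel.lift_ι]) }
  exact quasiIso_of_shortExact_of_acyclic hT hK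

section twoTerm

variable {L E : ι → A} (u : ∀ j, L (c.prev j) ⟶ E j)

open scoped Classical in
/-- The direct sum over `j` of the two-term complexes `u j : L (prev j) ⟶ E j`. -/
noncomputable def twoTerm : HomologicalComplex A c where
  X j := L j ⊞ E j
  -- `i` equals `c.prev j` only propositionally, hence the `eqToHom`.
  d i j := if h : c.Rel i j then
    biprod.fst ≫ eqToHom (by rw [c.prev_eq' h]) ≫ u j ≫ biprod.inr else 0
  shape i j h := dif_neg h
  d_comp_d' i j k hij hjk := by simp [dif_pos hij, dif_pos hjk]

namespace twoTerm

/-- The inclusion `L j ⟶ (twoTerm u).X j`. -/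
noncomputable def inl (j : ι) : L j ⟶ (twoTerm u).X j := (biprod.inl : L j ⟶ L j ⊞ E j)

/-- The inclusion `E j ⟶ (twoTerm u).X j`. -/
noncomputable def inr (j : ι) : E j ⟶ (twoTerm u).X j := (biprod.inr : E j ⟶ L j ⊞ E j)

/-- The projection `(twoTerm u).X j ⟶ L j`. -/
noncomputable def fst (j : ι) : (twoTerm u).X j ⟶ L j := (biprod.fst : L j ⊞ E j ⟶ L j)

/-- The projection `(twoTerm u).X j ⟶ E j`. -/
noncomputable def snd (j : ι) : (twoTerm u).X j ⟶ E j := (biprod.snd : L j ⊞ E j ⟶ E j)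

@[simp]
lemma inl_fst (j : ι) : inl u j ≫ fst u j = 𝟙 _ := biprod.inl_fst

@[simp]
lemma inl_snd (j : ι) : inl u j ≫ snd u j = 0 := biprod.inl_snd

@[simp]
lemma inr_fst (j : ι) : inr u j ≫ fst u j = 0 := biprod.inr_fst

@[simp]
lemma inr_snd (j : ι) : inr u j ≫ snd u j = 𝟙 _ := biprod.inr_snd

@[simp]
lemma inl_fst_assoc (j : ι) {T : A} (k : L j ⟶ T) : inl u j ≫ fst u j ≫ k = k :=
  (reassoc_of% (inl_fst u j)) k

@[simp]
lemma inl_snd_assoc (j : ι) {T : A} (k : E j ⟶ T) : inl u j ≫ snd u j ≫ k = 0 :=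
  ((reassoc_of% (inl_snd u j)) k).trans zero_comp

@[simp]
lemma inr_fst_assoc (j : ι) {T : A} (k : L j ⟶ T) : inr u j ≫ fst u j ≫ k = 0 :=
  ((reassoc_of% (inr_fst u j)) k).trans zero_comp

@[simp]
lemma inr_snd_assoc (j : ι) {T : A} (k : E j ⟶ T) : inr u j ≫ snd u j ≫ k = k :=
  (reassoc_of% (inr_snd u j)) k

instance (j : ι) : Epi (fst u j) :=
  SplitEpi.epi ⟨inl u j, inl_fst u j⟩

instance (j : ι) : Mono (inr u j) :=
  SplitMono.mono ⟨snd u j, inr_snd u j⟩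

variable {u}

lemma ext_from {j : ι} {T : A} {f g : (twoTerm u).X j ⟶ T} (hl : inl u j ≫ f = inl u j ≫ g)
    (hr : inr u j ≫ f = inr u j ≫ g) : f = g :=
  biprod.hom_ext' (X := L j) (Y := E j) f g hl hr

lemma ext_to {j : ι} {T : A} {f g : T ⟶ (twoTerm u).X j} (hl : f ≫ fst u j = g ≫ fst u j)
    (hr : f ≫ snd u j = g ≫ snd u j) : f = g :=
  biprod.hom_ext (X := L j) (Y := E j) f g hl hr

variable (u)

lemma d_prev {j : ι} (hj : c.Rel (c.prev j) j) :
    (twoTerm u).d (c.prev j) j = fst u (c.prev j) ≫ u j ≫ inr u j := by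
  simp [twoTerm, dif_pos hj, fst, inr]

@[simp]
lemma inr_d (i j : ι) : inr u i ≫ (twoTerm u).d i j = 0 := by
  by_cases h : c.Rel i j
  · obtain rfl := c.prev_eq' h
    simp [d_prev _ h]
  · rw [shape _ _ _ h, comp_zero]

lemma inl_d_prev {j : ι} (hj : c.Rel (c.prev j) j) :
    inl u (c.prev j) ≫ (twoTerm u).d (c.prev j) j = u j ≫ inr u j := by
  simp [d_prev _ hj]

variable {u}

/-- Morphisms out of `twoTerm u`. -/
noncomputable def desc {K : HomologicalComplex A c} (a : ∀ j, L j ⟶ K.X j)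
    (b : ∀ j, E j ⟶ K.X j)
    (hab : ∀ j, a (c.prev j) ≫ K.d (c.prev j) j = u j ≫ b j)
    (hb : ∀ i j, b i ≫ K.d i j = 0) : twoTerm u ⟶ K where
  f j := fst u j ≫ a j + snd u j ≫ b j
  comm' i j hij := by
    obtain rfl := c.prev_eq' hij
    apply ext_from
    · simp [hab, reassoc_of% (inl_d_prev _ hij)]
    · simp [hb, reassoc_of% (inr_d u)]

section

variable {K : HomologicalComplex A c} (a : ∀ j, L j ⟶ K.X j)
    (b : ∀ j, E j ⟶ K.X j) (hab : ∀ j, a (c.prev j) ≫ K.d (c.prev j) j = u j ≫ b j)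
    (hb : ∀ i j, b i ≫ K.d i j = 0)

@[simp]
lemma inl_desc_f (j : ι) : inl u j ≫ (desc a b hab hb).f j = a j := by
  simp [desc]

@[simp]
lemma inr_desc_f (j : ι) : inr u j ≫ (desc a b hab hb).f j = b j := by
  simp [desc]

@[simp]
lemma inl_desc_f_assoc (j : ι) {T : A} (k : K.X j ⟶ T) :
    inl u j ≫ (desc a b hab hb).f j ≫ k = a j ≫ k :=
  (reassoc_of% (inl_desc_f a b hab hb j)) k

@[simp]
lemma inr_desc_f_assoc (j : ι) {T : A} (k : K.X j ⟶ T) :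
    inr u j ≫ (desc a b hab hb).f j ≫ k = b j ≫ k :=
  (reassoc_of% (inr_desc_f a b hab hb j)) k

lemma hom_ext {f g : twoTerm u ⟶ K} (hl : ∀ j, inl u j ≫ f.f j = inl u j ≫ g.f j)
    (hr : ∀ j, inr u j ≫ f.f j = inr u j ≫ g.f j) : f = g := by
  ext j
  exact ext_from (hl j) (hr j)

end

/-- The differential is `fst` followed by monomorphisms, so cycles have no `L`-component. -/
lemma comp_fst_eq_zero {j : ι} (hj : c.Rel j (c.next j)) [∀ i, Mono (u i)] {T : A}
    (k : T ⟶ (twoTerm u).X j) (hk : k ≫ (twoTerm u).d j (c.next j) = 0) :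
    k ≫ fst u j = 0 := by
  generalize c.next j = n at hj hk
  obtain rfl := c.prev_eq' hj
  rw [d_prev _ hj] at hk
  rw [← cancel_mono (u n), ← cancel_mono (inr u n)]
  simpa using hk

/-- If `0 ⟶ L (prev j) ⟶ E j ⟶ M j ⟶ 0` is exact for all `j`, then `twoTerm u` is
quasi-isomorphic to the complex `M` with zero differential. -/
lemma quasiIso_desc (hnext : ∀ i, c.Rel i (c.next i)) (hprev : ∀ j, c.Rel (c.prev j) j)
    {M : HomologicalComplex A c} (hM : ∀ i j, M.d i j = 0) (p : ∀ j, E j ⟶ M.X j)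
    (hp : ∀ j, u j ≫ p j = 0) (hS : ∀ j, (ShortComplex.mk (u j) (p j) (hp j)).ShortExact)
    (hab) (hb) : QuasiIso (desc (u := u) (K := M) (fun _ => 0) p hab hb) := by
  refine ⟨fun j => ?_⟩
  rw [quasiIsoAt_iff]
  have hu : ∀ i, Mono (u i) := fun i => (hS i).mono_f
  -- The cycles in degree `j` are `E j` and the boundaries are the image of `L (prev j)`, so the
  -- homology is the cokernel `M.X j`.
  let hK : IsLimit (KernelFork.ofι (f := (twoTerm u).d j (c.next j))
      (inr u j) (inr_d u j _)) :=
    KernelFork.IsLimit.ofι' _ _ fun {T} k hk => ⟨k ≫ snd u j, by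
      apply ext_to
      · simp [comp_fst_eq_zero (hnext j) k hk]
      · simp⟩
  let f' : (twoTerm u).X (c.prev j) ⟶ E j := fst u _ ≫ u j
  have hf' : f' ≫ inr u j = (twoTerm u).d (c.prev j) j := by
    simp [f', d_prev _ (hprev j)]
  have hf'' : hK.lift (KernelFork.ofι _ ((twoTerm u).d_comp_d (c.prev j) j (c.next j))) = f' := by
    apply Fork.IsLimit.hom_ext hK
    exact (Fork.IsLimit.lift_ι hK).trans hf'.symm
  have hπ : f' ≫ p j = 0 := by simp [f', hp]
  have : Epi (p j) := (hS j).epi_g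
  let h₁ : ((twoTerm u).sc j).LeftHomologyData :=
    { K := E j
      H := M.X j
      i := inr u j
      π := p j
      wi := inr_d u j _
      hi := hK
      wπ := (congrArg (· ≫ p j) hf'').trans hπ
      hπ := CokernelCofork.IsColimit.ofπ' _ _ fun {T} k hk => ⟨(hS j).exact.desc k (by
          have hk' : f' ≫ k = 0 := (congrArg (· ≫ k) hf'').symm.trans hk
          rw [← cancel_epi (fst u (c.prev j)), comp_zero]
          exact (Category.assoc _ _ _).symm.trans hk'), (hS j).exact.g_desc _ _⟩ }
  let h₂ : (M.sc j).LeftHomologyData := .ofZeros _ (hM _ _) (hM _ _)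
  let γ : ShortComplex.LeftHomologyMapData ((shortComplexFunctor A c j).map
      (desc (u := u) (K := M) (fun _ => 0) p hab hb)) h₁ h₂ :=
    { φK := p j
      φH := 𝟙 _
      commi := (Category.comp_id _).trans (inr_desc_f (u := u) (fun _ => 0) p hab hb j).symm
      commf' := by
        have h : h₂.f' = 0 := by
          rw [← cancel_mono h₂.i, h₂.f'_i, zero_comp]
          exact hM _ _
        exact ((congrArg (· ≫ p j) hf'').trans hπ).trans (by rw [h, comp_zero]; rfl)
      commπ := rfl }
  rw [γ.quasiIso_iff]
  exact (inferInstance : IsIso (𝟙 (M.X j)))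

end twoTerm

end twoTerm

end HomologicalComplex

end

/-! ### Morphisms in the localization as roofs. -/

section

open Limits ZeroObject

namespace HomologicalComplex

variable {A : Type u} [Category.{v} A] [Abelian A] {ι : Type*} {c : ComplexShape ι}

/-- Every quasi-isomorphism becomes an epimorphism after adding an acyclic complex to its
source. -/
lemma exists_epi_quasiIso (hnext : ∀ i, c.Rel i (c.next i)) (hprev : ∀ j, c.Rel (c.prev j) j)
    {K L : HomologicalComplex A c} (w : K ⟶ L) [QuasiIso w] :
    ∃ (K' : HomologicalComplex A c) (i : K ⟶ K') (p : K' ⟶ K) (w' : K' ⟶ L),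
      i ≫ p = 𝟙 K ∧ i ≫ w' = w ∧ QuasiIso i ∧ Epi w' := by
  -- `C` is the acyclic complex with terms `L j ⊞ L (prev j)`; it maps onto `L` by the identity on
  -- `L j` and the differential on `L (prev j)`.
  let C : HomologicalComplex A c := twoTerm (fun j => 𝟙 (L.X (c.prev j)))
  let q : C ⟶ 0 := twoTerm.desc (fun _ => 0) (fun _ => 0) (by simp) (by simp)
  have : QuasiIso q := twoTerm.quasiIso_desc hnext hprev
    (fun i j => ((eval A c i).map_isZero (Limits.isZero_zero _)).eq_of_src _ _) _ (by simp)
    (fun j => { exact := by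
                  have : IsZero ((0 : HomologicalComplex A c).X j) :=
                    (eval A c j).map_isZero (Limits.isZero_zero _)
                  rw [ShortComplex.exact_iff_epi _ (this.eq_of_tgt _ _)]
                  dsimp; infer_instance
                mono_f := by dsimp; infer_instance
                epi_g := ⟨fun f g _ =>
                  (((eval A c j).map_isZero (Limits.isZero_zero _)).eq_of_src _ _)⟩ })
    _ _
  have hC : C.Acyclic := fun j => by
    rw [exactAt_iff_of_quasiIsoAt q, exactAt_iff_isZero_homology]
    exact (homologyFunctor A c j).map_isZero (Limits.isZero_zero _)
  let r : C ⟶ L := twoTerm.desc (fun j => 𝟙 (L.X j)) (fun j => L.d (c.prev j) j) (by simp) (by simp)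
  have hr : ∀ j, Epi (r.f j) := fun j =>
    epi_of_epi_fac (twoTerm.inl_desc_f _ _ _ _ j : _ = 𝟙 (L.X j))
  have : Epi r := epi_of_epi_f _ hr
  have : QuasiIso (biprod.snd : C ⊞ K ⟶ K) := quasiIso_of_shortExact_of_acyclic
    (ShortComplex.Splitting.ofHasBinaryBiproduct C K).shortExact hC
  refine ⟨C ⊞ K, biprod.inr, biprod.snd, biprod.desc r w, by simp, by simp, ?_, ?_⟩
  · have : QuasiIso ((biprod.inr : K ⟶ C ⊞ K) ≫ biprod.snd) := by
      rw [biprod.inr_snd]; infer_instance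
    exact quasiIso_of_comp_right _ (biprod.snd : C ⊞ K ⟶ K)
  · exact epi_of_epi_fac (biprod.inl_desc r w)

variable (A c) in
/-- The localization functor from complexes to the localization of the homotopy category at
quasi-isomorphisms. -/
noncomputable def toLocalization :
    HomologicalComplex A c ⥤ (HomotopyCategory.quasiIso A c).Localization :=
  HomotopyCategory.quotient A c ⋙ (HomotopyCategory.quasiIso A c).Q

namespace toLocalization

instance isIso_map {K L : HomologicalComplex A c} (f : K ⟶ L) [QuasiIso f] :
    IsIso ((toLocalization A c).map f) :=
  (HomotopyCategory.quasiIso A c).Q_inverts _ (by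
    rw [HomotopyCategory.quotient_map_mem_quasiIso_iff]
    assumption)

/-- The target of a roof is prescribed only by an equality of objects; injectivity on the nose
allows this equality to be eliminated. -/
lemma obj_injective : Function.Injective (toLocalization A c).obj := fun _ _ h =>
  congrArg (fun X : HomotopyCategory A c => X.as)
    ((Localization.Construction.objEquiv (HomotopyCategory.quasiIso A c)).injective h)

/-- A morphism in the localization is a roof if it is of the form `q⁻¹ ≫ f` for a morphism of
complexes `f` and a quasi-isomorphism `q`. -/
def IsRoof {M : HomologicalComplex A c} {Y : (HomotopyCategory.quasiIso A c).Localization}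
    (α : (toLocalization A c).obj M ⟶ Y) : Prop :=
  ∃ (R K : HomologicalComplex A c) (q : R ⟶ M) (_ : QuasiIso q) (f : R ⟶ K)
    (e : (toLocalization A c).obj K = Y),
    (toLocalization A c).map q ≫ α = (toLocalization A c).map f ≫ eqToHom e

variable (A c) in
/-- The morphisms which preserve roofs by postcomposition. -/
def preservesRoofs : MorphismProperty (HomotopyCategory.quasiIso A c).Localization :=
  fun X _ g => ∀ (M : HomologicalComplex A c) (α : (toLocalization A c).obj M ⟶ X),
    IsRoof α → IsRoof (α ≫ g)

instance : (preservesRoofs A c).IsStableUnderComposition where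
  comp_mem f g hf hg M α hα := by
    rw [← Category.assoc]
    exact hg M _ (hf M _ hα)

lemma preservesRoofs_map {K L : HomologicalComplex A c} (f : K ⟶ L) :
    preservesRoofs A c ((toLocalization A c).map f) := by
  rintro M α ⟨R, K', q, hq, g, e, h⟩
  obtain rfl := obj_injective e
  exact ⟨R, L, q, hq, g ≫ f, rfl, by simp [reassoc_of% h]⟩

/-- Once `w` is replaced by an epimorphic quasi-isomorphism, the numerator of the roof can be pulled
back along it, and the base change is again a quasi-isomorphism. This is the Ore condition without
homotopies. -/
lemma preservesRoofs_inv (hnext : ∀ i, c.Rel i (c.next i)) (hprev : ∀ j, c.Rel (c.prev j) j)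
    {K L : HomologicalComplex A c} (w : K ⟶ L) [QuasiIso w] :
    preservesRoofs A c (inv ((toLocalization A c).map w)) := by
  rintro M α ⟨R, L', q, hq, g, e, h⟩
  obtain rfl := obj_injective e
  obtain ⟨K', i, p, w', hip, hiw, hi, hw'⟩ := exists_epi_quasiIso hnext hprev w
  have : QuasiIso w' := by
    have : QuasiIso (i ≫ w') := by rwa [hiw]
    exact quasiIso_of_comp_left i w'
  have := quasiIso_pullback_fst g w'
  refine ⟨pullback g w', K, pullback.fst g w' ≫ q, inferInstance, pullback.snd g w' ≫ p, rfl, ?_⟩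
  have h1 : inv ((toLocalization A c).map w) = inv ((toLocalization A c).map w') ≫
      (toLocalization A c).map p := by
    rw [IsIso.inv_eq_of_hom_inv_id]
    rw [← hiw, Functor.map_comp, Category.assoc, IsIso.hom_inv_id_assoc, ← Functor.map_comp, hip,
      CategoryTheory.Functor.map_id]
  rw [eqToHom_refl, Category.comp_id] at h ⊢
  rw [Functor.map_comp, Category.assoc, reassoc_of% h, h1, ← Functor.map_comp_assoc,
    pullback.condition, Functor.map_comp_assoc, IsIso.hom_inv_id_assoc, Functor.map_comp]

/-- Every morphism in the localization is a roof. -/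
lemma exists_roof (hnext : ∀ i, c.Rel i (c.next i)) (hprev : ∀ j, c.Rel (c.prev j) j)
    {M N : HomologicalComplex A c} (α : (toLocalization A c).obj M ⟶ (toLocalization A c).obj N) :
    ∃ (R : HomologicalComplex A c) (q : R ⟶ M) (_ : QuasiIso q) (f : R ⟶ N),
      (toLocalization A c).map q ≫ α = (toLocalization A c).map f := by
  -- The localization is generated under composition by images of morphisms and formal inverses of
  -- quasi-isomorphisms. The result is then applied to the trivial roof `𝟙 M`.
  have h := Localization.Construction.morphismProperty_eq_top (preservesRoofs A c)
    (fun X Y f => by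
      obtain ⟨X, rfl⟩ := HomotopyCategory.quotient_obj_surjective X
      obtain ⟨Y, rfl⟩ := HomotopyCategory.quotient_obj_surjective Y
      obtain ⟨f, rfl⟩ := (HomotopyCategory.quotient A c).map_surjective f
      exact preservesRoofs_map f)
    (fun X Y w hw => by
      obtain ⟨X, rfl⟩ := HomotopyCategory.quotient_obj_surjective X
      obtain ⟨Y, rfl⟩ := HomotopyCategory.quotient_obj_surjective Y
      obtain ⟨w, rfl⟩ := (HomotopyCategory.quotient A c).map_surjective w
      have hw' := hw
      rw [HomotopyCategory.quotient_map_mem_quasiIso_iff] at hw'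
      have : QuasiIso w := hw'
      have e : inv ((toLocalization A c).map w) = Localization.Construction.wInv _ hw :=
        IsIso.inv_eq_of_hom_inv_id (Localization.Construction.wIso _ hw).hom_inv_id
      exact (congrArg (fun g => preservesRoofs A c g) e).mp (preservesRoofs_inv hnext hprev w))
  obtain ⟨R, K, q, hq, f, e, h⟩ := (by rw [h]; trivial : preservesRoofs A c α) M (𝟙 _)
    ⟨M, M, 𝟙 M, inferInstance, 𝟙 M, rfl, by simp⟩
  obtain rfl := obj_injective e
  exact ⟨R, q, hq, f, by simpa using h⟩

end toLocalization

end HomologicalComplex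

end

/-! ### Resolving roofs by extensions: surjectivity. -/

section

open Limits

namespace CategoryTheory.Abelian.Ext

variable {A : Type u} [Category.{v} A] [Abelian A] [HasExt.{w} A] {X Y : A} (x : Ext X Y 1)

/-- The middle term of an extension of class `x`. -/
noncomputable def middle : A := (exists_shortExact x).choose

/-- The monomorphism of an extension of class `x`. -/
noncomputable def ι : Y ⟶ middle x := (exists_shortExact x).choose_spec.choose

/-- The epimorphism of an extension of class `x`. -/
noncomputable def π : middle x ⟶ X := (exists_shortExact x).choose_spec.choose_spec.choose

@[simp]
lemma ι_π : ι x ≫ π x = 0 := (exists_shortExact x).choose_spec.choose_spec.choose_spec.choose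

lemma shortExact : (ShortComplex.mk (ι x) (π x) (ι_π x)).ShortExact :=
  (exists_shortExact x).choose_spec.choose_spec.choose_spec.choose_spec.choose

@[simp]
lemma extClass_shortExact : (shortExact x).extClass = x :=
  (exists_shortExact x).choose_spec.choose_spec.choose_spec.choose_spec.choose_spec

variable {x}

/-- An extension whose class is pushed forward to the class of a short exact sequence maps to this
short exact sequence. -/
lemma exists_middle_hom {Y' Z : A} (a : Y ⟶ Y') {i : Y' ⟶ Z} {p : Z ⟶ X} {h : i ≫ p = 0}
    (hS : (ShortComplex.mk i p h).ShortExact)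
    (hx : x.comp (mk₀ a) (add_zero 1) = hS.extClass) :
    ∃ g : middle x ⟶ Z, ι x ≫ g = a ≫ i ∧ g ≫ p = π x := by
  obtain ⟨φ, h₁, h₃⟩ := exists_shortComplex_hom (shortExact x) hS a (𝟙 X) (by simp [hx])
  refine ⟨φ.τ₂, ?_, ?_⟩
  · have := φ.comm₁₂
    dsimp at this
    rw [← this, h₁]
  · have := φ.comm₂₃
    dsimp at this
    rw [this, h₃]
    exact Category.comp_id _

end CategoryTheory.Abelian.Ext

namespace HomologicalComplex

/-- If `q : R ⟶ M` is a quasi-isomorphism to a complex with zero differential, then the cycles of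
`R` are an extension of `M` by the cycles of the kernel of `q`. -/
lemma shortExact_cycles {A : Type u} [Category.{v} A] [Abelian A] {ι : Type*}
    {c : ComplexShape ι} {M : HomologicalComplex A c} (hM : ∀ i j, M.d i j = 0)
    {R : HomologicalComplex A c} (q : R ⟶ M) [QuasiIso q] (j : ι) :
    (ShortComplex.mk (cyclesMap (kernel.ι q) j) (R.iCycles j ≫ q.f j) (by
      rw [cyclesMap_i_assoc, ← comp_f, kernel.condition, zero_f, comp_zero])).ShortExact where
  exact := by
    let S := ShortComplex.mk (kernel.ι q) q (kernel.condition q)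
    -- Exactness comes from left exactness of cycles; composing with the monomorphism `M.iCycles j`
    -- does not affect it.
    let φ : ShortComplex.mk (cyclesMap S.f j) (cyclesMap S.g j)
        (by rw [← cyclesMap_comp, S.zero, cyclesMap_zero]) ⟶
        ShortComplex.mk (cyclesMap (kernel.ι q) j) (R.iCycles j ≫ q.f j) (by
          rw [cyclesMap_i_assoc, ← comp_f, kernel.condition, zero_f, comp_zero]) :=
      { τ₁ := 𝟙 _
        τ₂ := 𝟙 _
        τ₃ := M.iCycles j
        comm₁₂ := (Category.id_comp _).trans (Category.comp_id _).symm
        comm₂₃ := (Category.id_comp _).trans (cyclesMap_i q j).symm }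
    have h₁ : Epi φ.τ₁ := inferInstanceAs (Epi (𝟙 _))
    have h₂ : IsIso φ.τ₂ := inferInstanceAs (IsIso (𝟙 _))
    have h₃ : Mono φ.τ₃ := inferInstanceAs (Mono (M.iCycles j))
    exact (ShortComplex.exact_iff_of_epi_of_isIso_of_mono φ).1
      (cycles_left_exact S (ShortComplex.exact_kernel q) j)
  mono_f := inferInstanceAs (Mono (cyclesMap (kernel.ι q) j))
  epi_g := epi_iCycles_comp_of_quasiIsoAt q j (hM _ _) (hM _ _)

variable {A : Type u} [Category.{v} A] [Abelian A] [HasExt.{w} A] {ι : Type*}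
  {c : ComplexShape ι}

namespace toLocalization

variable {M N : HomologicalComplex A c} (hM : ∀ i j, M.d i j = 0) (hN : ∀ i j, N.d i j = 0)

/-- The complex resolving `M` by extensions of `M j` by `N (prev j)` of given classes. -/
noncomputable abbrev extComplex (e : ∀ j, Ext (M.X j) (N.X (c.prev j)) 1) :
    HomologicalComplex A c :=
  twoTerm fun j => Ext.ι (e j)

/-- The projection from `extComplex e` to `M`. -/
noncomputable def extComplexπ (e : ∀ j, Ext (M.X j) (N.X (c.prev j)) 1) : extComplex e ⟶ M :=
  twoTerm.desc (fun _ => 0) (fun j => Ext.π (e j)) (by simp) (by simp [hM])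

/-- The morphism from `extComplex e` to `N` which is the identity on `N` and is given by `ψ` on
the quotient `M`. -/
noncomputable def extComplexDesc (e : ∀ j, Ext (M.X j) (N.X (c.prev j)) 1)
    (ψ : ∀ j, M.X j ⟶ N.X j) : extComplex e ⟶ N :=
  twoTerm.desc (fun j => 𝟙 (N.X j)) (fun j => Ext.π (e j) ≫ ψ j)
    (by simp [hN, reassoc_of% @Ext.ι_π]) (by simp [hN])

lemma quasiIso_extComplexπ (hnext : ∀ i, c.Rel i (c.next i)) (hprev : ∀ j, c.Rel (c.prev j) j)
    (e : ∀ j, Ext (M.X j) (N.X (c.prev j)) 1) : QuasiIso (extComplexπ hM e) :=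
  twoTerm.quasiIso_desc hnext hprev hM _ _ (fun j => Ext.shortExact (e j)) _ _

/-- With `K` the acyclic kernel of `q`, the cycles of `R` extend `M j` by the cycles of `K`, onto
which `K (prev j)` surjects. Heredity lifts the class to `y j` in `Ext¹(M j, K (prev j))`, and `P`
is built from the `y j`. Pushing `y j` forward along `K ⟶ R ⟶ N` gives `e j`; on the extensions, `P
⟶ R ⟶ N` vanishes on `K (prev j)` because `N` has zero differential, whence `ψ j`. -/
lemma exists_extComplex_of_quasiIso (hnext : ∀ i, c.Rel i (c.next i))
    (hprev : ∀ j, c.Rel (c.prev j) j) (hA : IsHereditary A) {R : HomologicalComplex A c}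
    (q : R ⟶ M) [QuasiIso q] (f : R ⟶ N) :
    ∃ (P : HomologicalComplex A c) (e : ∀ j, Ext (M.X j) (N.X (c.prev j)) 1)
      (ψ : ∀ j, M.X j ⟶ N.X j) (r : P ⟶ R) (s : P ⟶ extComplex e),
      r ≫ q = s ≫ extComplexπ hM e ∧ r ≫ f = s ≫ extComplexDesc hN e ψ ∧ QuasiIso (r ≫ q) := by
  have hq : ∀ j, Epi (q.f j) := fun j => epi_f_of_quasiIsoAt q j (hM _ _) (hM _ _)
  have := epi_of_epi_f q hq
  let K := kernel q
  have hK : K.Acyclic := ShortComplex.ShortExact.acyclic_X₁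
    (S := ShortComplex.mk (kernel.ι q) q (kernel.condition q))
    { exact := ShortComplex.exact_kernel q } ‹_›
  have hK' : ∀ j, Epi (K.toCycles (c.prev j) j) := fun j => (hK j).epi_toCycles
  have hy : ∀ j, ∃ y : Ext (M.X j) (K.X (c.prev j)) 1,
      y.comp (Ext.mk₀ (K.toCycles (c.prev j) j)) (add_zero 1) =
        (shortExact_cycles hM q j).extClass := fun j =>
    have := hA (M.X j)
    Ext.postcomp_surjective_of_epi _ _ _
  choose y hy using hy
  have hh : ∀ j, ∃ h : Ext.middle (y j) ⟶ R.cycles j,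
      Ext.ι (y j) ≫ h = K.toCycles (c.prev j) j ≫ cyclesMap (kernel.ι q) j ∧
      h ≫ R.iCycles j ≫ q.f j = Ext.π (y j) := fun j =>
    Ext.exists_middle_hom _ (shortExact_cycles hM q j) (hy j)
  choose h hh₁ hh₂ using hh
  let φ : K ⟶ N := kernel.ι q ≫ f
  let e : ∀ j, Ext (M.X j) (N.X (c.prev j)) 1 := fun j =>
    (y j).comp (Ext.mk₀ (φ.f (c.prev j))) (add_zero 1)
  have hg : ∀ j, ∃ g : Ext.middle (y j) ⟶ Ext.middle (e j),
      Ext.ι (y j) ≫ g = φ.f (c.prev j) ≫ Ext.ι (e j) ∧ g ≫ Ext.π (e j) = Ext.π (y j) := fun j =>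
    Ext.exists_middle_hom _ (Ext.shortExact (e j)) (Ext.extClass_shortExact (e j)).symm
  choose g hg₁ hg₂ using hg
  have hιh : ∀ j, Ext.ι (y j) ≫ h j ≫ R.iCycles j = K.d (c.prev j) j ≫ (kernel.ι q).f j := by
    intro j
    rw [reassoc_of% hh₁ j, cyclesMap_i, toCycles_i_assoc]
  have hπ : ∀ j, Epi (Ext.π (y j)) := fun j => (Ext.shortExact (y j)).epi_g
  have hψ : ∀ j, ∃ ψ : M.X j ⟶ N.X j, Ext.π (y j) ≫ ψ = h j ≫ R.iCycles j ≫ f.f j := fun j =>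
    ⟨(Ext.shortExact (y j)).exact.desc (h j ≫ R.iCycles j ≫ f.f j) (by
      dsimp only
      rw [reassoc_of% hιh j, ← comp_f, ← Hom.comm, hN, comp_zero]),
      (Ext.shortExact (y j)).exact.g_desc _ _⟩
  choose ψ hψ using hψ
  let r : twoTerm (fun j => Ext.ι (y j)) ⟶ R :=
    twoTerm.desc (fun j => (kernel.ι q).f j) (fun j => h j ≫ R.iCycles j)
      (fun j => by rw [hιh, Hom.comm]) (by simp)
  let s : twoTerm (fun j => Ext.ι (y j)) ⟶ extComplex e :=
    twoTerm.desc (fun j => φ.f j ≫ twoTerm.inl (fun j => Ext.ι (e j)) j)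
      (fun j => g j ≫ twoTerm.inr (fun j => Ext.ι (e j)) j)
      (fun j => by rw [Category.assoc, twoTerm.inl_d_prev _ (hprev j), reassoc_of% hg₁]) (by simp)
  have hrq : r ≫ q = twoTerm.desc (fun _ => 0) (fun j => Ext.π (y j)) (by simp) (by simp [hM]) :=
    twoTerm.hom_ext (fun j => by
      have : (kernel.ι q).f j ≫ q.f j = 0 := by rw [← comp_f, kernel.condition, zero_f]
      simp [r, this]) (fun j => by simp [r, hh₂])
  refine ⟨_, e, ψ, r, s, ?_, ?_, ?_⟩
  · rw [hrq]
    exact twoTerm.hom_ext (fun j => by simp [s, extComplexπ])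
      (fun j => by simp [s, extComplexπ, hg₂])
  · apply twoTerm.hom_ext
    · intro j
      simp [r, s, extComplexDesc, φ]
    · intro j
      simp [r, s, extComplexDesc, reassoc_of% hg₂, hψ]
  · rw [hrq]
    exact twoTerm.quasiIso_desc hnext hprev hM _ _ (fun j => Ext.shortExact (y j)) _ _

/-- The morphism in the localization attached to extension classes and morphisms between the
components. -/
noncomputable def homMk (hnext : ∀ i, c.Rel i (c.next i)) (hprev : ∀ j, c.Rel (c.prev j) j)
    (e : ∀ j, Ext (M.X j) (N.X (c.prev j)) 1) (ψ : ∀ j, M.X j ⟶ N.X j) :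
    (toLocalization A c).obj M ⟶ (toLocalization A c).obj N :=
  have := quasiIso_extComplexπ hM hnext hprev e
  inv ((toLocalization A c).map (extComplexπ hM e)) ≫
    (toLocalization A c).map (extComplexDesc hN e ψ)

lemma map_extComplexπ_homMk (hnext : ∀ i, c.Rel i (c.next i)) (hprev : ∀ j, c.Rel (c.prev j) j)
    (e : ∀ j, Ext (M.X j) (N.X (c.prev j)) 1) (ψ : ∀ j, M.X j ⟶ N.X j) :
    (toLocalization A c).map (extComplexπ hM e) ≫ homMk hM hN hnext hprev e ψ =
      (toLocalization A c).map (extComplexDesc hN e ψ) :=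
  have := quasiIso_extComplexπ hM hnext hprev e
  IsIso.hom_inv_id_assoc _ _

lemma homMk_surjective (hnext : ∀ i, c.Rel i (c.next i)) (hprev : ∀ j, c.Rel (c.prev j) j)
    (hA : IsHereditary A) (α : (toLocalization A c).obj M ⟶ (toLocalization A c).obj N) :
    ∃ e ψ, homMk hM hN hnext hprev e ψ = α := by
  obtain ⟨R, q, hq, f, hα⟩ := exists_roof hnext hprev α
  obtain ⟨P, e, ψ, r, s, h₁, h₂, h₃⟩ := exists_extComplex_of_quasiIso hM hN hnext hprev hA q f
  refine ⟨e, ψ, ?_⟩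
  rw [← cancel_epi ((toLocalization A c).map (r ≫ q))]
  conv_lhs => rw [h₁]
  rw [Functor.map_comp, Category.assoc, map_extComplexπ_homMk, ← Functor.map_comp, ← h₂,
    Functor.map_comp, Functor.map_comp, Category.assoc, hα]

end toLocalization

end HomologicalComplex

end

/-! ### Cones of morphisms in degree `0` and connecting morphisms. -/

section

open Limits

namespace CochainComplex

open HomComplex mappingCone

variable {A : Type u} [Category.{v} A] [Abelian A]

/-- The degree `0` component of a single complex in degree `0`. -/
noncomputable def singleXIso (X : A) : ((singleFunctor A 0).obj X).X 0 ≅ X :=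
  HomologicalComplex.singleObjXSelf (.up ℤ) 0 X

lemma singleFunctor_map_f_singleXIso_hom {X Y : A} (f : X ⟶ Y) :
    ((singleFunctor A 0).map f).f 0 ≫ (singleXIso Y).hom = (singleXIso X).hom ≫ f := by
  have : ((singleFunctor A 0).map f).f 0 = (singleXIso X).hom ≫ f ≫ (singleXIso Y).inv :=
    HomologicalComplex.single_map_f_self (c := .up ℤ) 0 f
  rw [this, Category.assoc, Category.assoc, Iso.inv_hom_id, Category.comp_id]

section

variable {X Y : A} {f : X ⟶ Y} {P : CochainComplex A ℤ} (l : X ⟶ P.X (-1)) (r : Y ⟶ P.X 0)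
  (hlr : l ≫ P.d (-1) 0 = f ≫ r) (hr : r ≫ P.d 0 1 = 0)

/-- A morphism from the single complex in degree `0`. -/
noncomputable def fromSingle : (singleFunctor A 0).obj Y ⟶ P :=
  Cocycle.homOf (Cocycle.fromSingleMk r (add_zero 0) 1 (by norm_num) hr)

/-- A morphism from the mapping cone of a morphism in degree `0`, given by its
components in degrees `-1` and `0`. -/
noncomputable def coneSingleDesc : mappingCone ((singleFunctor A 0).map f) ⟶ P :=
  desc _ (Cochain.fromSingleMk l (zero_add (-1))) (fromSingle r hr) (by
    rw [Cochain.δ_fromSingleMk _ _ 0 0 (add_zero 0), hlr, Cochain.fromSingleMk_precomp,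
      Cochain.ofHom_comp, fromSingle, Cocycle.cochain_ofHom_homOf_eq_coe]
    rfl)

@[simp]
lemma fromSingle_f : (fromSingle r hr).f 0 = (singleXIso Y).hom ≫ r :=
  Cochain.fromSingleMk_v r (add_zero 0)

@[simp]
lemma inl_v_coneSingleDesc_f :
    (inl ((singleFunctor A 0).map f)).v 0 (-1) (by simp) ≫ (coneSingleDesc l r hlr hr).f (-1) =
      (singleXIso X).hom ≫ l :=
  (inl_v_desc_f _ _ _ _ _ _ _).trans (Cochain.fromSingleMk_v l (zero_add (-1)))

@[simp]
lemma inr_f_coneSingleDesc_f :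
    (inr ((singleFunctor A 0).map f)).f 0 ≫ (coneSingleDesc l r hlr hr).f 0 =
      (singleXIso Y).hom ≫ r :=
  (inr_f_desc_f _ _ _ _ _).trans (fromSingle_f r hr)

end

lemma coneSingle_hom_ext {X Y : A} {a : X ⟶ Y} {P : CochainComplex A ℤ}
    {f g : mappingCone ((singleFunctor A 0).map a) ⟶ P}
    (h₁ : (inl ((singleFunctor A 0).map a)).v 0 (-1) (by simp) ≫ f.f (-1) =
      (inl ((singleFunctor A 0).map a)).v 0 (-1) (by simp) ≫ g.f (-1))
    (h₂ : (inr ((singleFunctor A 0).map a)).f 0 ≫ f.f 0 =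
      (inr ((singleFunctor A 0).map a)).f 0 ≫ g.f 0) : f = g := by
  ext i
  apply ext_from _ (i + 1) i rfl
  · by_cases hi : i = -1
    · subst hi
      exact h₁
    · exact (HomologicalComplex.isZero_single_obj_X (ComplexShape.up ℤ) 0 _ _
        (by omega)).eq_of_src _ _
  · by_cases hi : i = 0
    · subst hi
      exact h₂
    · exact (HomologicalComplex.isZero_single_obj_X (ComplexShape.up ℤ) 0 _ _ hi).eq_of_src _ _

section

variable {N : CochainComplex A ℤ} {Y : A}

/-- A morphism to a shifted single complex. -/
noncomputable def toSingleShift (n : N.X (-1) ⟶ Y) (hn : N.d (-2) (-1) ≫ n = 0) :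
    N ⟶ ((singleFunctor A 0).obj Y)⟦(1 : ℤ)⟧ :=
  -- The sign matches the one in the third morphism of the mapping cone triangle.
  Cocycle.homOf ((-Cocycle.toSingleMk n (neg_add_cancel 1) (-2) (by norm_num) hn).rightShift 1 0
    (zero_add 1))

lemma toSingleShift_f (n : N.X (-1) ⟶ Y) (hn : N.d (-2) (-1) ≫ n = 0) :
    (toSingleShift n hn).f (-1) = -(n ≫ (singleXIso Y).inv ≫
      (((singleFunctor A 0).obj Y).shiftFunctorObjXIso 1 (-1) 0 (by simp)).inv) := by
  refine ((-Cochain.toSingleMk n (neg_add_cancel 1)).rightShift_v 1 0 (zero_add 1) (-1) (-1)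
    (by simp) 0 (by simp)).trans ?_
  have : (Cochain.toSingleMk n (neg_add_cancel 1)).v (-1) 0 (by simp) = n ≫ (singleXIso Y).inv :=
    Cochain.toSingleMk_v _ _
  rw [Cochain.neg_v, this, Preadditive.neg_comp, Category.assoc]

/-- A morphism to a single complex. -/
noncomputable def toSingle (n : N.X 0 ⟶ Y) (hn : N.d (-1) 0 ≫ n = 0) :
    N ⟶ (singleFunctor A 0).obj Y :=
  Cocycle.homOf (Cocycle.toSingleMk n (add_zero 0) (-1) (by norm_num) hn)

lemma toSingle_f (n : N.X 0 ⟶ Y) (hn : N.d (-1) 0 ≫ n = 0) :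
    (toSingle n hn).f 0 = n ≫ (singleXIso Y).inv :=
  Cochain.toSingleMk_v n (add_zero 0)

end

end CochainComplex

namespace CochainComplex

open HomComplex mappingCone

variable {A : Type u} [Category.{v} A] [Abelian A]
  {X Y Z : A} {f : X ⟶ Y} {g : Y ⟶ Z} (h : f ≫ g = 0)
  {P M N : CochainComplex A ℤ} (q : P ⟶ M) (k : P ⟶ N)
  (l : X ⟶ P.X (-1)) (r : Y ⟶ P.X 0)
  (hlr : l ≫ P.d (-1) 0 = f ≫ r) (hr : r ≫ P.d 0 1 = 0)

/-- The image of a short complex by the single functor in degree `0`. -/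
noncomputable abbrev singleShortComplex : ShortComplex (CochainComplex A ℤ) :=
  ShortComplex.mk ((singleFunctor A 0).map f) ((singleFunctor A 0).map g)
    (by rw [← Functor.map_comp, h, Functor.map_zero])

/-- The projection of the cone of `f` in degree `0` to the third term of a short complex. -/
noncomputable def coneSingleProj :
    mappingCone ((singleFunctor A 0).map f) ⟶ (singleFunctor A 0).obj Z :=
  descShortComplex (singleShortComplex h)

@[simp]
lemma inl_v_coneSingleProj_f :
    (inl ((singleFunctor A 0).map f)).v 0 (-1) (by simp) ≫ (coneSingleProj h).f (-1) = 0 :=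
  inl_v_descShortComplex_f (singleShortComplex h) _ _ _

@[simp]
lemma inr_f_coneSingleProj_f :
    (inr ((singleFunctor A 0).map f)).f 0 ≫ (coneSingleProj h).f 0 =
      ((singleFunctor A 0).map g).f 0 :=
  inr_f_descShortComplex_f (singleShortComplex h) _

variable (f) in
/-- The connecting morphism of the cone of `f` in degree `0`. -/
noncomputable def coneSingleδ :
    mappingCone ((singleFunctor A 0).map f) ⟶ ((singleFunctor A 0).obj X)⟦(1 : ℤ)⟧ :=
  (triangle ((singleFunctor A 0).map f)).mor₃

variable (f) in
lemma inl_v_coneSingleδ_f :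
    (inl ((singleFunctor A 0).map f)).v 0 (-1) (by simp) ≫ (coneSingleδ f).f (-1) =
      -(((singleFunctor A 0).obj X).shiftFunctorObjXIso 1 (-1) 0 (by simp)).inv :=
  inl_v_triangle_mor₃_f _ _ _ _

lemma coneSingleDesc_comp (m : Z ⟶ M.X 0) (hm : m ≫ M.d 0 1 = 0) (hl : l ≫ q.f (-1) = 0)
    (hm' : r ≫ q.f 0 = g ≫ m) :
    coneSingleDesc l r hlr hr ≫ q = coneSingleProj h ≫ fromSingle m hm := by
  apply coneSingle_hom_ext
  · simp [hl, reassoc_of% @inl_v_coneSingleDesc_f, reassoc_of% @inl_v_coneSingleProj_f]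
  · simp [hm', reassoc_of% @inr_f_coneSingleDesc_f, reassoc_of% @inr_f_coneSingleProj_f,
      reassoc_of% @singleFunctor_map_f_singleXIso_hom]

lemma coneSingleDesc_comp_toSingle {T : A} (n : N.X 0 ⟶ T) (hn : N.d (-1) 0 ≫ n = 0) (b : Z ⟶ T)
    (hb : r ≫ k.f 0 ≫ n = g ≫ b) :
    coneSingleDesc l r hlr hr ≫ k ≫ toSingle n hn =
      coneSingleProj h ≫ (singleFunctor A 0).map b := by
  apply coneSingle_hom_ext
  · exact (HomologicalComplex.isZero_single_obj_X (ComplexShape.up ℤ) 0 T (-1)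
      (by simp)).eq_of_tgt _ _
  · rw [HomologicalComplex.comp_f, HomologicalComplex.comp_f, HomologicalComplex.comp_f,
      reassoc_of% @inr_f_coneSingleDesc_f, reassoc_of% @inr_f_coneSingleProj_f, toSingle_f,
      reassoc_of% hb, ← cancel_mono (singleXIso T).hom]
    simp [singleFunctor_map_f_singleXIso_hom, reassoc_of% @singleFunctor_map_f_singleXIso_hom]

lemma coneSingleDesc_comp_toSingleShift (n : N.X (-1) ⟶ X) (hn : N.d (-2) (-1) ≫ n = 0)
    (hl : l ≫ k.f (-1) ≫ n = 𝟙 X) :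
    coneSingleDesc l r hlr hr ≫ k ≫ toSingleShift n hn = coneSingleδ f := by
  apply coneSingle_hom_ext
  · rw [inl_v_coneSingleδ_f, HomologicalComplex.comp_f, HomologicalComplex.comp_f,
      reassoc_of% @inl_v_coneSingleDesc_f, toSingleShift_f]
    simp only [Preadditive.comp_neg, reassoc_of% hl, Iso.hom_inv_id_assoc]
  · exact (HomologicalComplex.isZero_single_obj_X (ComplexShape.up ℤ) 0 X (0 + 1)
      (by simp)).eq_of_tgt _ _

end CochainComplex

namespace DerivedCategory

open CochainComplex HomComplex mappingCone

variable {A : Type u} [Category.{v} A] [Abelian A] [HasDerivedCategory.{w} A]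
  {X Y Z : A} {f : X ⟶ Y} {g : Y ⟶ Z} (h : f ≫ g = 0) (hS : (singleShortComplex h).ShortExact)
  {P M N : CochainComplex A ℤ} (q : P ⟶ M) (k : P ⟶ N)
  (l : X ⟶ P.X (-1)) (r : Y ⟶ P.X 0)
  (hlr : l ≫ P.d (-1) 0 = f ≫ r) (hr : r ≫ P.d 0 1 = 0)
  (m : Z ⟶ M.X 0) (hm : m ≫ M.d 0 1 = 0) (hl : l ≫ q.f (-1) = 0)
  (hm' : r ≫ q.f 0 = g ≫ m)
  (θ : Q.obj M ⟶ Q.obj N) (hθ : Q.map q ≫ θ = Q.map k)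

include hS hlr hr hl hm' hθ

/-- The cone of `f` is quasi-isomorphic to `Z` and maps to `P`. After precomposition with the cone,
`θ` is replaced by the actual morphism `k`, and the identity is checked on complexes. -/
lemma map_fromSingle_comp_toSingle {T : A} (n : N.X 0 ⟶ T) (hn : N.d (-1) 0 ≫ n = 0) (b : Z ⟶ T)
    (hb : r ≫ k.f 0 ≫ n = g ≫ b) :
    Q.map (fromSingle m hm) ≫ θ ≫ Q.map (toSingle n hn) =
      Q.map ((CochainComplex.singleFunctor A 0).map b) := by
  have : QuasiIso (coneSingleProj h) := mappingCone.quasiIso_descShortComplex hS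
  rw [← cancel_epi (Q.map (coneSingleProj h)), ← Functor.map_comp_assoc,
    ← coneSingleDesc_comp h q l r hlr hr m hm hl hm', Functor.map_comp_assoc, reassoc_of% hθ,
    ← Functor.map_comp, ← Functor.map_comp, ← Functor.map_comp,
    coneSingleDesc_comp_toSingle h k l r hlr hr n hn b hb]

lemma map_fromSingle_comp_toSingleShift (n : N.X (-1) ⟶ X) (hn : N.d (-2) (-1) ≫ n = 0)
    (hl' : l ≫ k.f (-1) ≫ n = 𝟙 X) :
    Q.map (fromSingle m hm) ≫ θ ≫ Q.map (toSingleShift n hn) ≫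
      (Q.commShiftIso (1 : ℤ)).hom.app _ = triangleOfSESδ hS := by
  have : QuasiIso (coneSingleProj h) := mappingCone.quasiIso_descShortComplex hS
  rw [← cancel_epi (Q.map (coneSingleProj h)), ← Functor.map_comp_assoc,
    ← coneSingleDesc_comp h q l r hlr hr m hm hl hm', Functor.map_comp_assoc, reassoc_of% hθ,
    ← Functor.map_comp_assoc, ← Functor.map_comp_assoc, Category.assoc,
    coneSingleDesc_comp_toSingleShift k l r hlr hr n hn hl']
  exact (descShortComplex_triangleOfSESδ hS).symm

end DerivedCategory

namespace CategoryTheory.Abelian.Ext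

variable {A : Type u} [Category.{v} A] [Abelian A] [HasExt.{w} A]

/-- Both classes arise from the connecting morphisms by composing with the same isomorphisms, which
depend only on `X` and `Z`. -/
lemma extClass_eq_of_triangleOfSESδ_eq [HasDerivedCategory.{w'} A] {X Z Y Y' : A} {f : X ⟶ Y}
    {g : Y ⟶ Z} {h : f ≫ g = 0} (hS : (ShortComplex.mk f g h).ShortExact) {f' : X ⟶ Y'}
    {g' : Y' ⟶ Z} {h' : f' ≫ g' = 0} (hS' : (ShortComplex.mk f' g' h').ShortExact)
    (hT : (CochainComplex.singleShortComplex h).ShortExact)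
    (hT' : (CochainComplex.singleShortComplex h').ShortExact)
    (H : DerivedCategory.triangleOfSESδ hT = DerivedCategory.triangleOfSESδ hT') :
    hS.extClass = hS'.extClass := by
  ext
  rw [ShortComplex.ShortExact.extClass_hom, ShortComplex.ShortExact.extClass_hom]
  exact congrArg (fun t => ((SingleFunctors.evaluation _ _ 0).mapIso
    (DerivedCategory.singleFunctorsPostcompQIso A)).hom.app Z ≫ t ≫
      (((SingleFunctors.evaluation _ _ 0).mapIso
      (DerivedCategory.singleFunctorsPostcompQIso A)).inv.app X)⟦(1 : ℤ)⟧') H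

end CategoryTheory.Abelian.Ext

end

/-! ### Unrolling complexes along a path in the shape. -/

section

open Limits

namespace ComplexShape

variable {ι : Type*} (c : ComplexShape ι)

/-- The bi-infinite path through `j` obtained by iterating `next` and `prev`. -/
noncomputable def path (j : ι) : ℤ → ι
  -- The values at `0` and `-1` are `j` and `c.prev j` by computation, so that identities can later
  -- serve as comparison maps.
  | Int.ofNat n => c.next^[n] j
  | Int.negSucc n => c.prev^[n + 1] j

lemma path_rel (hnext : ∀ i, c.Rel i (c.next i)) (hprev : ∀ j, c.Rel (c.prev j) j) (j : ι) :
    ∀ n : ℤ, c.Rel (c.path j n) (c.path j (n + 1))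
  | Int.ofNat n => by
    have : c.path j (Int.ofNat n + 1) = c.next (c.path j (Int.ofNat n)) :=
      Function.iterate_succ_apply' c.next n j
    rw [this]
    exact hnext _
  | Int.negSucc 0 => hprev j
  | Int.negSucc (n + 1) => by
    have h₁ : c.path j (Int.negSucc (n + 1)) = c.prev (c.path j (Int.negSucc n)) :=
      Function.iterate_succ_apply' c.prev (n + 1) j
    have h₂ : Int.negSucc (n + 1) + 1 = Int.negSucc n := by omega
    rw [h₁, h₂]
    exact hprev _

end ComplexShape

namespace HomologicalComplex

variable {A : Type u} [Category.{v} A] [Abelian A] {ι : Type*} {c : ComplexShape ι}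
  (a : ℤ → ι)

/-- The cochain complex obtained by reading a complex along a path in the complex shape. -/
def unroll : HomologicalComplex A c ⥤ CochainComplex A ℤ where
  obj M :=
    { X := fun n => M.X (a n)
      -- The condition is needed because the path may revisit indices: `a n` and `a m` can be
      -- related without `n + 1 = m`.
      d := fun n m => if n + 1 = m then M.d (a n) (a m) else 0
      shape := fun n m h => if_neg h
      d_comp_d' := fun n m k h₁ h₂ => by
        obtain rfl : n + 1 = m := h₁
        obtain rfl : n + 1 + 1 = k := h₂
        simp }
  map f :=
    { f := fun n => f.f (a n)
      comm' := fun n m h => by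
        obtain rfl : n + 1 = m := h
        simp }

lemma unroll_obj_d (M : HomologicalComplex A c) (n m : ℤ) (h : n + 1 = m) :
    ((unroll a).obj M).d n m = M.d (a n) (a m) :=
  if_pos h

/-- Unrolling does not change the short complexes which compute homology. -/
def unrollScIso (M : HomologicalComplex A c) (n : ℤ) :
    ((unroll a).obj M).sc' n (n + 1) (n + 1 + 1) ≅ M.sc' (a n) (a (n + 1)) (a (n + 1 + 1)) :=
  ShortComplex.isoMk (Iso.refl _) (Iso.refl _) (Iso.refl _)
    ((Category.id_comp _).trans ((unroll_obj_d a M n (n + 1) rfl).symm.trans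
      (Category.comp_id _).symm))
    ((Category.id_comp _).trans ((unroll_obj_d a M (n + 1) (n + 1 + 1) rfl).symm.trans
      (Category.comp_id _).symm))

variable {a} (ha : ∀ n, c.Rel (a n) (a (n + 1)))

/-- The unrolling of the components of a homotopy. -/
def unrollHom {K L : HomologicalComplex A c} (a : ℤ → ι) (s : ∀ i j, K.X i ⟶ L.X j) (n m : ℤ) :
    ((unroll a).obj K).X n ⟶ ((unroll a).obj L).X m :=
  if m + 1 = n then s (a n) (a m) else 0

lemma unrollHom_eq {K L : HomologicalComplex A c} (s : ∀ i j, K.X i ⟶ L.X j) (n m : ℤ)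
    (h : m + 1 = n) : unrollHom a s n m = s (a n) (a m) :=
  if_pos h

/-- The unrolling of a homotopy. -/
def unrollHomotopy {K L : HomologicalComplex A c} {f g : K ⟶ L} (h : Homotopy f g) :
    Homotopy ((unroll a).map f) ((unroll a).map g) where
  hom := unrollHom a h.hom
  zero n m hnm := if_neg hnm
  comm n := by
    obtain ⟨n, rfl⟩ : ∃ m, n = m + 1 := ⟨n - 1, by omega⟩
    rw [dNext_eq _ (show (ComplexShape.up ℤ).Rel (n + 1) (n + 1 + 1) from rfl),
      prevD_eq _ (show (ComplexShape.up ℤ).Rel n (n + 1) from rfl), unrollHom_eq _ _ _ rfl,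
      unrollHom_eq _ _ _ rfl, unroll_obj_d _ _ _ _ rfl, unroll_obj_d _ _ _ _ rfl]
    have := h.comm (a (n + 1))
    rw [dNext_eq _ (ha (n + 1)), prevD_eq _ (ha n)] at this
    exact this

include ha in
lemma quasiIso_unroll_map {K L : HomologicalComplex A c} (f : K ⟶ L) [QuasiIso f] :
    QuasiIso ((unroll a).map f) where
  quasiIsoAt n := by
    obtain ⟨n, rfl⟩ : ∃ m, n = m + 1 := ⟨n - 1, by omega⟩
    rw [quasiIsoAt_iff' _ n (n + 1) (n + 1 + 1) (by simp) (by simp)]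
    have := (quasiIsoAt_iff' f (a n) (a (n + 1)) (a (n + 1 + 1)) (c.prev_eq' (ha n))
      (c.next_eq' (ha (n + 1)))).1 inferInstance
    have e : Arrow.mk ((shortComplexFunctor' A c (a n) (a (n + 1)) (a (n + 1 + 1))).map f) ≅
        Arrow.mk ((shortComplexFunctor' A (ComplexShape.up ℤ) n (n + 1) (n + 1 + 1)).map
          ((unroll a).map f)) :=
      Arrow.isoMk (unrollScIso a K n).symm (unrollScIso a L n).symm (by
        ext
        · exact (Category.id_comp _).trans (Category.comp_id _).symm
        · exact (Category.id_comp _).trans (Category.comp_id _).symm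
        · exact (Category.id_comp _).trans (Category.comp_id _).symm)
    exact ShortComplex.quasiIso_of_arrow_mk_iso _ _ e

namespace toLocalization

variable [HasDerivedCategory.{w'} A]

/-- The functor induced by unrolling from the homotopy category to the derived category. -/
noncomputable def unrollHomotopyCategory : HomotopyCategory A c ⥤ DerivedCategory A :=
  CategoryTheory.Quotient.lift _ (unroll a ⋙ DerivedCategory.Q) (by
    rintro K L f g ⟨h⟩
    exact DerivedCategory.Q_map_eq_of_homotopy _ (unrollHomotopy ha h))

lemma isInvertedBy_unrollHomotopyCategory :
    (HomotopyCategory.quasiIso A c).IsInvertedBy (unrollHomotopyCategory ha) := by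
  intro X Y w hw
  obtain ⟨X, rfl⟩ := HomotopyCategory.quotient_obj_surjective X
  obtain ⟨Y, rfl⟩ := HomotopyCategory.quotient_obj_surjective Y
  obtain ⟨w, rfl⟩ := (HomotopyCategory.quotient A c).map_surjective w
  rw [HomotopyCategory.quotient_map_mem_quasiIso_iff] at hw
  have : QuasiIso w := hw
  have := quasiIso_unroll_map ha w
  exact inferInstanceAs (IsIso (DerivedCategory.Q.map ((unroll a).map w)))

/-- The functor induced by unrolling from the localization to the derived category. -/
noncomputable def unrollLocalization :
    (HomotopyCategory.quasiIso A c).Localization ⥤ DerivedCategory A :=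
  Localization.Construction.lift _ (isInvertedBy_unrollHomotopyCategory ha)

/-- The functors `unrollLocalization` and `unroll` are compatible. -/
noncomputable def unrollLocalizationIso :
    toLocalization A c ⋙ unrollLocalization ha ≅ unroll a ⋙ DerivedCategory.Q :=
  Functor.isoWhiskerLeft (HomotopyCategory.quotient A c)
    (eqToIso (Localization.Construction.fac _ (isInvertedBy_unrollHomotopyCategory ha)))

/-- The action of the unrolling functor on morphisms. -/
noncomputable def unrollMap {M N : HomologicalComplex A c}
    (α : (toLocalization A c).obj M ⟶ (toLocalization A c).obj N) :
    DerivedCategory.Q.obj ((unroll a).obj M) ⟶ DerivedCategory.Q.obj ((unroll a).obj N) :=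
  (unrollLocalizationIso ha).inv.app M ≫ (unrollLocalization ha).map α ≫
    (unrollLocalizationIso ha).hom.app N

lemma map_comp_unrollMap {R M N : HomologicalComplex A c}
    (α : (toLocalization A c).obj M ⟶ (toLocalization A c).obj N) (q : R ⟶ M) (f : R ⟶ N)
    (h : (toLocalization A c).map q ≫ α = (toLocalization A c).map f) :
    DerivedCategory.Q.map ((unroll a).map q) ≫ unrollMap ha α =
      DerivedCategory.Q.map ((unroll a).map f) := by
  have h₁ := (unrollLocalizationIso ha).inv.naturality q
  have h₂ := (unrollLocalizationIso ha).inv.naturality f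
  dsimp at h₁ h₂
  rw [unrollMap, reassoc_of% h₁, ← Functor.map_comp_assoc, h, ← reassoc_of% h₂]
  simp

end toLocalization

end HomologicalComplex

end

/-! ### Recovering the data from the unrolled morphism: injectivity. -/

section

open Limits

namespace HomologicalComplex.toLocalization

variable {A : Type u} [Category.{v} A] [Abelian A] {ι : Type*} {c : ComplexShape ι}

lemma unroll_obj_d_eq_zero {K : HomologicalComplex A c} (hK : ∀ i j, K.d i j = 0) (a : ℤ → ι)
    (n m : ℤ) : ((unroll a).obj K).d n m = 0 := by
  by_cases h : n + 1 = m
  · exact (unroll_obj_d a K n m h).trans (hK _ _)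
  · exact shape _ _ _ h

lemma comp_unroll_d_eq_zero {K : HomologicalComplex A c} (hK : ∀ i j, K.d i j = 0) (a : ℤ → ι)
    (n m : ℤ) {T : A} (f : T ⟶ ((unroll a).obj K).X n) : f ≫ ((unroll a).obj K).d n m = 0 := by
  rw [unroll_obj_d_eq_zero hK, comp_zero]

lemma unroll_d_comp_eq_zero {K : HomologicalComplex A c} (hK : ∀ i j, K.d i j = 0) (a : ℤ → ι)
    (n m : ℤ) {T : A} (f : ((unroll a).obj K).X m ⟶ T) : ((unroll a).obj K).d n m ≫ f = 0 := by
  rw [unroll_obj_d_eq_zero hK, zero_comp]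

/-- The identity, as a morphism to the unrolling of `K` in degree `0`. -/
noncomputable def toUnroll (K : HomologicalComplex A c) (j : ι) :
    K.X j ⟶ ((unroll (c.path j)).obj K).X 0 :=
  𝟙 (K.X j)

/-- The identity, as a morphism from the unrolling of `K` in degree `0`. -/
noncomputable def fromUnroll (K : HomologicalComplex A c) (j : ι) :
    ((unroll (c.path j)).obj K).X 0 ⟶ K.X j :=
  𝟙 (K.X j)

/-- The identity, as a morphism from the unrolling of `K` in degree `-1`. -/
noncomputable def fromUnrollPrev (K : HomologicalComplex A c) (j : ι) :
    ((unroll (c.path j)).obj K).X (-1) ⟶ K.X (c.prev j) :=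
  𝟙 (K.X (c.prev j))

variable [HasExt.{w} A] {M N : HomologicalComplex A c}
  (hM : ∀ i j, M.d i j = 0) (hN : ∀ i j, N.d i j = 0)
  (hnext : ∀ i, c.Rel i (c.next i)) (hprev : ∀ j, c.Rel (c.prev j) j)

/-- The inclusion of `N (prev j)` in the unrolling of `extComplex e`. -/
noncomputable def unrollInl (e : ∀ j, Ext (M.X j) (N.X (c.prev j)) 1) (j : ι) :
    N.X (c.prev j) ⟶ ((unroll (c.path j)).obj (extComplex e)).X (-1) :=
  twoTerm.inl (fun j => Ext.ι (e j)) (c.prev j)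

/-- The inclusion of the extension of class `e j` in the unrolling of `extComplex e`. -/
noncomputable def unrollInr (e : ∀ j, Ext (M.X j) (N.X (c.prev j)) 1) (j : ι) :
    Ext.middle (e j) ⟶ ((unroll (c.path j)).obj (extComplex e)).X 0 :=
  twoTerm.inr (fun j => Ext.ι (e j)) j

lemma unrollInl_d (e : ∀ j, Ext (M.X j) (N.X (c.prev j)) 1) (j : ι) (hj : c.Rel (c.prev j) j) :
    unrollInl e j ≫ ((unroll (c.path j)).obj (extComplex e)).d (-1) 0 =
      Ext.ι (e j) ≫ unrollInr e j :=
  (congrArg (unrollInl e j ≫ ·)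
    (unroll_obj_d (c.path j) (extComplex e) (-1) 0 (by norm_num))).trans
    (twoTerm.inl_d_prev _ hj)

lemma unrollInr_d (e : ∀ j, Ext (M.X j) (N.X (c.prev j)) 1) (j : ι) :
    unrollInr e j ≫ ((unroll (c.path j)).obj (extComplex e)).d 0 1 = 0 :=
  (congrArg (unrollInr e j ≫ ·)
    (unroll_obj_d (c.path j) (extComplex e) 0 1 (by norm_num))).trans
    (twoTerm.inr_d _ _ _)

lemma inl_extComplexπ_f (e : ∀ j, Ext (M.X j) (N.X (c.prev j)) 1) (j : ι) :
    twoTerm.inl (fun j => Ext.ι (e j)) j ≫ (extComplexπ hM e).f j = 0 :=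
  twoTerm.inl_desc_f _ _ _ _ _

lemma inr_extComplexπ_f (e : ∀ j, Ext (M.X j) (N.X (c.prev j)) 1) (j : ι) :
    twoTerm.inr (fun j => Ext.ι (e j)) j ≫ (extComplexπ hM e).f j = Ext.π (e j) :=
  twoTerm.inr_desc_f _ _ _ _ _

lemma inl_extComplexDesc_f (e : ∀ j, Ext (M.X j) (N.X (c.prev j)) 1) (ψ : ∀ j, M.X j ⟶ N.X j)
    (j : ι) : twoTerm.inl (fun j => Ext.ι (e j)) j ≫ (extComplexDesc hN e ψ).f j = 𝟙 _ :=
  twoTerm.inl_desc_f _ _ _ _ _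

lemma inr_extComplexDesc_f (e : ∀ j, Ext (M.X j) (N.X (c.prev j)) 1) (ψ : ∀ j, M.X j ⟶ N.X j)
    (j : ι) : twoTerm.inr (fun j => Ext.ι (e j)) j ≫ (extComplexDesc hN e ψ).f j =
      Ext.π (e j) ≫ ψ j :=
  twoTerm.inr_desc_f _ _ _ _ _

lemma shortExact_single (e : ∀ j, Ext (M.X j) (N.X (c.prev j)) 1) (j : ι) :
    (CochainComplex.singleShortComplex (Ext.ι_π (e j))).ShortExact :=
  (Ext.shortExact (e j)).map_of_exact (HomologicalComplex.single A (ComplexShape.up ℤ) 0)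

variable [HasDerivedCategory.{w'} A]

/-- As the differentials vanish, `M j` and `N j` split off in degree `0` of the unrolled complexes;
the matrix entry of the morphism between them is `ψ j`. -/
lemma fromSingle_unrollMap_homMk_toSingle (e : ∀ j, Ext (M.X j) (N.X (c.prev j)) 1)
    (ψ : ∀ j, M.X j ⟶ N.X j) (j : ι) :
    DerivedCategory.Q.map (CochainComplex.fromSingle (toUnroll M j)
        (comp_unroll_d_eq_zero hM _ _ _ _)) ≫
      unrollMap (c.path_rel hnext hprev j) (homMk hM hN hnext hprev e ψ) ≫
      DerivedCategory.Q.map (CochainComplex.toSingle (fromUnroll N j)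
        (unroll_d_comp_eq_zero hN _ _ _ _)) =
    DerivedCategory.Q.map ((CochainComplex.singleFunctor A 0).map (ψ j)) :=
  DerivedCategory.map_fromSingle_comp_toSingle (Ext.ι_π (e j)) (shortExact_single e j)
    ((unroll (c.path j)).map (extComplexπ hM e))
    ((unroll (c.path j)).map (extComplexDesc hN e ψ))
    (unrollInl e j) (unrollInr e j) (unrollInl_d e j (hprev j)) (unrollInr_d e j) (toUnroll M j) _
    (inl_extComplexπ_f hM e (c.prev j))
    ((inr_extComplexπ_f hM e j).trans (Category.comp_id _).symm) _
    (map_comp_unrollMap _ _ _ _ (map_extComplexπ_homMk hM hN hnext hprev e ψ))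
    (fromUnroll N j) _ (ψ j)
    ((congrArg (_ ≫ ·) (Category.comp_id _)).trans (inr_extComplexDesc_f hN e ψ j))

/-- The entry towards `N (prev j)`, which sits in degree `-1`, is the connecting morphism of the
extension and so determines `e j`. -/
lemma fromSingle_unrollMap_homMk_toSingleShift (e : ∀ j, Ext (M.X j) (N.X (c.prev j)) 1)
    (ψ : ∀ j, M.X j ⟶ N.X j) (j : ι) :
    DerivedCategory.Q.map (CochainComplex.fromSingle (toUnroll M j)
        (comp_unroll_d_eq_zero hM _ _ _ _)) ≫
      unrollMap (c.path_rel hnext hprev j) (homMk hM hN hnext hprev e ψ) ≫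
      DerivedCategory.Q.map (CochainComplex.toSingleShift (fromUnrollPrev N j)
        (unroll_d_comp_eq_zero hN _ _ _ _)) ≫
      (DerivedCategory.Q.commShiftIso (1 : ℤ)).hom.app _ =
    DerivedCategory.triangleOfSESδ (shortExact_single e j) :=
  DerivedCategory.map_fromSingle_comp_toSingleShift (Ext.ι_π (e j)) (shortExact_single e j)
    ((unroll (c.path j)).map (extComplexπ hM e))
    ((unroll (c.path j)).map (extComplexDesc hN e ψ))
    (unrollInl e j) (unrollInr e j) (unrollInl_d e j (hprev j)) (unrollInr_d e j) (toUnroll M j) _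
    (inl_extComplexπ_f hM e (c.prev j))
    ((inr_extComplexπ_f hM e j).trans (Category.comp_id _).symm) _
    (map_comp_unrollMap _ _ _ _ (map_extComplexπ_homMk hM hN hnext hprev e ψ))
    (fromUnrollPrev N j) _
    ((congrArg (_ ≫ ·) (Category.comp_id _)).trans (inl_extComplexDesc_f hN e ψ (c.prev j)))

end HomologicalComplex.toLocalization

namespace HomologicalComplex.toLocalization

variable {A : Type u} [Category.{v} A] [Abelian A] [HasExt.{w} A] {ι : Type*}
  {c : ComplexShape ι} {M N : HomologicalComplex A c}
  (hM : ∀ i j, M.d i j = 0) (hN : ∀ i j, N.d i j = 0)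
  (hnext : ∀ i, c.Rel i (c.next i)) (hprev : ∀ j, c.Rel (c.prev j) j)

lemma homMk_injective {e e' : ∀ j, Ext (M.X j) (N.X (c.prev j)) 1} {ψ ψ' : ∀ j, M.X j ⟶ N.X j}
    (h : homMk hM hN hnext hprev e ψ = homMk hM hN hnext hprev e' ψ') : e = e' ∧ ψ = ψ' := by
  let : HasDerivedCategory A := HasDerivedCategory.standard A
  constructor
  · ext1 j
    have h₁ := fromSingle_unrollMap_homMk_toSingleShift hM hN hnext hprev e ψ j
    have h₂ := fromSingle_unrollMap_homMk_toSingleShift hM hN hnext hprev e' ψ' j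
    rw [h] at h₁
    have := Ext.extClass_eq_of_triangleOfSESδ_eq (Ext.shortExact (e j)) (Ext.shortExact (e' j))
      _ _ (h₁.symm.trans h₂)
    rwa [Ext.extClass_shortExact, Ext.extClass_shortExact] at this
  · ext1 j
    have h₁ := fromSingle_unrollMap_homMk_toSingle hM hN hnext hprev e ψ j
    have h₂ := fromSingle_unrollMap_homMk_toSingle hM hN hnext hprev e' ψ' j
    rw [h] at h₁
    exact (DerivedCategory.singleFunctor A 0).map_injective (h₁.symm.trans h₂)

/-- Morphisms in the localization between complexes with zero differential over a hereditary
category. -/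
noncomputable def homEquiv (hA : IsHereditary A) :
    ((∀ j, Ext (M.X j) (N.X (c.prev j)) 1) × (∀ j, M.X j ⟶ N.X j)) ≃
      ((toLocalization A c).obj M ⟶ (toLocalization A c).obj N) :=
  Equiv.ofBijective (fun p => homMk hM hN hnext hprev p.1 p.2)
    ⟨fun _ _ h => Prod.ext_iff.2 (homMk_injective hM hN hnext hprev h), fun α =>
      have ⟨e, ψ, h⟩ := homMk_surjective hM hN hnext hprev hA α
      ⟨(e, ψ), h⟩⟩

end HomologicalComplex.toLocalization

end

/-! ### Counting morphisms and the alternating product. -/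

namespace PeriodicComplex

variable {A : Type u} [Category.{v} A] [Abelian A] [HasExt.{w} A] {t : ℕ}

/-- Morphisms in the relative derived category between complexes with zero differential over a
hereditary category are given by classes in `Ext¹` and morphisms of the components. -/
noncomputable def homEquivOfIsHereditary {M N : PeriodicComplex A t}
    (hM : ∀ i j, M.d i j = 0) (hN : ∀ i j, N.d i j = 0) (hA : IsHereditary A) :
    ((∀ j, Ext (M.X j) (N.X (j - 1)) 1) × (∀ j, M.X j ⟶ N.X j)) ≃
      (toDerived.obj M ⟶ toDerived.obj N) :=
  (Equiv.prodCongr (Equiv.piCongrRight fun j => Equiv.cast (by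
      rw [CochainComplex.prev])) (.refl _)).trans
    (HomologicalComplex.toLocalization.homEquiv hM hN
      (fun i => by rw [(ComplexShape.up (ZMod t)).next_eq' (j := i + 1) rfl]; rfl)
      (fun j => by
        rw [CochainComplex.prev]
        exact sub_add_cancel j 1) hA)

lemma finite_hom (hfin : IsFinitary.{w} A) (hA : IsHereditary A) [NeZero t]
    {M N : PeriodicComplex A t} (hM : ∀ i j, M.d i j = 0) (hN : ∀ i j, N.d i j = 0) :
    Finite (toDerived.obj M ⟶ toDerived.obj N) :=
  have := hfin.finite_hom
  have := hfin.finite_ext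
  .of_equiv _ (homEquivOfIsHereditary hM hN hA)

lemma card_hom (hA : IsHereditary A) [NeZero t]
    {M N : PeriodicComplex A t} (hM : ∀ i j, M.d i j = 0) (hN : ∀ i j, N.d i j = 0) :
    Nat.card (toDerived.obj M ⟶ toDerived.obj N) =
      ∏ j, (Nat.card (M.X j ⟶ N.X j) * Nat.card (Ext (M.X j) (N.X (j - 1)) 1)) := by
  rw [← Nat.card_congr (homEquivOfIsHereditary hM hN hA), Nat.card_prod, Nat.card_pi, Nat.card_pi,
    Finset.prod_mul_distrib, mul_comm]

end PeriodicComplex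

lemma ZMod.prod_range_natCast {R : Type*} [CommMonoid R] (t : ℕ) [NeZero t] (f : ZMod t → R) :
    ∏ i ∈ Finset.range t, f i = ∏ j, f j :=
  Finset.prod_nbij' (fun i => (i : ZMod t)) ZMod.val (by simp) (by simp [ZMod.val_lt])
    (fun i hi => ZMod.val_cast_of_lt (Finset.mem_range.1 hi)) (by simp) (by simp)

/-- Cancellation of the alternating products over the shifts. -/
lemma prod_range_zpow_eq {t : ℕ} [NeZero t] (ht : Odd t) {K : Type*} [Field K]
    (h e : ZMod t → ZMod t → K) :
    ∏ n ∈ Finset.range t, (∏ j, (h (j + n) j * e (j + n) (j - 1))) ^ ((-1 : ℤ) ^ n) =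
    ∏ j, (h j j * e j j * ∏ m ∈ Finset.Ico 1 t, (h (j + m) j / e (j + m) j) ^ ((-1 : ℤ) ^ m)) := by
  have h₁ : ∀ n : ℕ, ∏ j, e (j + n) (j - 1) = ∏ j, e (j + (n + 1 : ℕ)) j := fun n =>
    Fintype.prod_equiv (Equiv.subRight 1) _ _ fun j => by
      simp
  have h₂ : ∏ n ∈ Finset.range t, (∏ j, e (j + (n + 1 : ℕ)) j) ^ ((-1 : ℤ) ^ n) =
      (∏ j, e j j) * ∏ m ∈ Finset.Ico 1 t, (∏ j, (e (j + m) j)⁻¹) ^ ((-1 : ℤ) ^ m) := by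
    -- The last factor `n = t - 1` has even exponent and `j + t = j`, so it gives `e j j`. The
    -- others, with `m = n + 1`, become inverses with sign `(-1) ^ m`.
    obtain ⟨s, rfl⟩ : ∃ s, t = s + 1 := ⟨t - 1, by have := ht.pos; omega⟩
    have hs : Even s := by simpa [Nat.odd_add_one] using ht
    rw [Finset.prod_range_succ, mul_comm, hs.neg_one_pow, zpow_one, Finset.prod_Ico_eq_prod_range]
    congr 1
    · simp only [ZMod.natCast_self, add_zero]
    · refine Finset.prod_congr rfl fun n _ => ?_
      rw [add_comm 1 n, pow_succ, mul_neg_one, Finset.prod_inv_distrib, inv_zpow', neg_neg]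
  have h₃ : ∏ n ∈ Finset.range t, (∏ j, h (j + n) j) ^ ((-1 : ℤ) ^ n) =
      (∏ j, h j j) * ∏ m ∈ Finset.Ico 1 t, (∏ j, h (j + m) j) ^ ((-1 : ℤ) ^ m) := by
    rw [Finset.range_eq_Ico, Finset.prod_eq_prod_Ico_succ_bot ht.pos]
    simp
  simp only [Finset.prod_mul_distrib, mul_zpow, h₁]
  rw [h₂, h₃, Finset.prod_comm]
  simp only [div_eq_mul_inv, Finset.prod_mul_distrib, mul_zpow, Finset.prod_zpow]
  ring

open PeriodicComplex in
theorem proposition5p3 (k : Type*) [Field k] [Finite k]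
    {A : Type u} [Category.{v} A] [Abelian A] [Linear k A] [HasExt.{w} A]
    (hfin : IsFinitary.{w} A) (hher : IsHereditary A)
    (t : ℕ) (ht : Odd t)
    (A₁ A₂ : PeriodicComplex A t)
    (hA₁ : ∀ i j, A₁.d i j = 0) (hA₂ : ∀ i j, A₂.d i j = 0) :
    (∀ i ∈ Finset.range t,
      Finite (PeriodicComplex.toDerived.obj ((PeriodicComplex.shift (i : ℤ)).obj A₁) ⟶
        PeriodicComplex.toDerived.obj A₂)) ∧
    ∏ i ∈ Finset.range t,
      (Nat.card (PeriodicComplex.toDerived.obj ((PeriodicComplex.shift (i : ℤ)).obj A₁) ⟶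
        PeriodicComplex.toDerived.obj A₂) : ℚ) ^ ((-1 : ℤ) ^ i) =
    ∏ i ∈ Finset.range t,
      ((Nat.card (A₁.X (i : ZMod t) ⟶ A₂.X (i : ZMod t)) : ℚ) *
        (Nat.card (Ext (A₁.X (i : ZMod t)) (A₂.X (i : ZMod t)) 1) : ℚ) *
        ∏ m ∈ Finset.Ico 1 t,
          eulerForm (A₁.X ((i : ZMod t) + (m : ZMod t))) (A₂.X (i : ZMod t)) ^ ((-1 : ℤ) ^ m)) := by
  have : NeZero t := ⟨ht.pos.ne'⟩
  have hd : ∀ (n : ℕ) i j, ((shift (n : ℤ)).obj A₁).d i j = 0 := fun n i j => by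
    rw [shift_obj_d, hA₁, smul_zero]
    rfl
  refine ⟨fun n _ => finite_hom hfin hher (hd n) hA₂, ?_⟩
  rw [ZMod.prod_range_natCast t fun i => (Nat.card (A₁.X i ⟶ A₂.X i) : ℚ) *
        (Nat.card (Ext (A₁.X i) (A₂.X i) 1) : ℚ) *
        ∏ m ∈ Finset.Ico 1 t, eulerForm (A₁.X (i + (m : ZMod t))) (A₂.X i) ^ ((-1 : ℤ) ^ m)]
  -- The shift by `n` has components `A₁.X (j + n)`, so `card_hom` produces the factors `h (j + n)
  -- j` and `e (j + n) (j - 1)`.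
  refine Eq.trans (Finset.prod_congr rfl fun n _ => ?_)
    (prod_range_zpow_eq ht (fun i j => (Nat.card (A₁.X i ⟶ A₂.X j) : ℚ))
      (fun i j => (Nat.card (Ext (A₁.X i) (A₂.X j) 1) : ℚ)))
  rw [card_hom hher (hd n) hA₂]
  push_cast
  simp
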